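/- For an integer $k\ge 1$ define on $(0,\infty)$ the functions $u_1=1$, $u_2=x$, $u_3=x^{2k-2}$, $u_4=x^{2k}$, $u_5=x^{2k+1}$, $u_6=x^{4k-2}$, $u_9=x^{6k-2}$, $u_{12}=x(1+x^{4k})$, $u_{13}=x^{4k}+x^2$, $u_{15}=(x^{4k}+x^2)\arctan(x^{2k-1})$, $u_{16}=(x^{4k-2}+1)(2kx^{4k-1}+x)$, $u_{17}=(x^{4k-2}+1)(2kx^{4k-1}+x)\arctan(x^{2k-1})$, and the ordered families $$\mathcal F_1^k=[u_1,u_{12},u_4],\quad \mathcal F_2^k=[u_{13},u_{15},u_5,u_2],\quad \mathcal F_4^k=[u_4,u_9,u_6,u_3,u_{16},u_{17}],\quad \mathcal F_6^k=[u_1,u_4,u_9,u_6,u_3,u_{16},u_{17}].$$ For an ordered family $\mathcal F=[v_0,\dots,v_n]$ of smooth functions on $[a,b]$, let $\mathcal Z(\mathcal F)$ be the maximal number of zeros in $[a,b]$, counted with multiplicity, of an element of $\operatorname{Span}(\mathcal F)$ that is not identically zero on $[a,b]$; $\mathcal F$ is called an ET-system with accuracy $j$ on $[a,b]$ if $\mathcal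 Z(\mathcal F)=n+j$. For $0\le i\le n$ let $W_i=\det\big(v_c^{(r)}\big)_{0\le r,c\le i}$ be the Wronskian of $v_0,\dots,v_i$. Let $\mathcal F=[v_0,\dots,v_n]$ be one of the families $\mathcal F_1^k$ ($k\ge1$), $\mathcal F_2^k$ ($k\ge2$), $\mathcal F_4^k$ ($k>2$), $\mathcal F_6^2$. Then $W_0,\dots,W_{n-1}$ have no zero in $(0,\infty)$, and $W_n$ has exactly one zero $\xi$ in $(0,\infty)$, and this zero is simple. Moreover, for all $0<a<b$: if $\xi\in[a,b]$, then $\mathcal F$ is an ET-system with accuracy $1$ on $[a,b]$, that is, $\mathcal Z(\mathcal F)=n+1$; if $\xi\notin[a,b]$, then $\mathcal F$ is an ET-system with accuracy $0$ on $[a,b]$, that is, $\mathcal Z(\mathcal F)=n$. In particular $\mathcal Z(\mathcal F)\le n+1$ on every $[a,b]\subset(0,\infty)$. -/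

import Mathlib

open scoped ContDiff

noncomputable section

/-- The Wronskian of an ordered list `v 0, …, v (m - 1)` of real functions: the determinant of the
matrix whose row `r` holds the derivatives of order `r`. -/
def wronskian {m : ℕ} (v : Fin m → ℝ → ℝ) (x : ℝ) : ℝ :=
  (Matrix.of fun r c : Fin m => iteratedDeriv (r : ℕ) (v c) x).det

/-- The Wronskian `W_i = W(u_0, …, u_i)` of the first `i + 1` members of `[u_0, …, u_n]`. -/
def leadingWronskian {n : ℕ} (u : Fin (n + 1) → ℝ → ℝ) (i : Fin (n + 1)) : ℝ → ℝ :=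
  wronskian fun j : Fin ((i : ℕ) + 1) => u (Fin.castLE i.isLt j)

/-- The multiplicity of `x` as a zero of a smooth function `f` on `[a, b]`: the least order of a
derivative of `f` (one-sided at the end points) that does not vanish at `x`, and `⊤` if they all
vanish. It is `0` exactly when `f x ≠ 0`. -/
def zeroMultiplicity (a b : ℝ) (f : ℝ → ℝ) (x : ℝ) : ℕ∞ :=
  ⨅ (j : ℕ) (_ : iteratedDerivWithin j f (Set.Icc a b) x ≠ 0), (j : ℕ∞)

/-- The number of zeros of `f` in `[a, b]`, counted with multiplicity. -/
def zeroCount (a b : ℝ) (f : ℝ → ℝ) : ℕ∞ :=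
  ⨆ (S : Finset ℝ) (_ : (S : Set ℝ) ⊆ Set.Icc a b), ∑ x ∈ S, zeroMultiplicity a b f x

/-- The maximal number of zeros in `[a, b]`, counted with multiplicity, of a linear combination of
`u_0, …, u_n` that is not identically zero on `[a, b]`. -/
def maxZeros {n : ℕ} (a b : ℝ) (u : Fin (n + 1) → ℝ → ℝ) : ℕ∞ :=
  ⨆ (f : ℝ → ℝ) (_ : f ∈ Submodule.span ℝ (Set.range u)) (_ : ∃ x ∈ Set.Icc a b, f x ≠ 0),
    zeroCount a b f

/-- `[u_0, …, u_n]` is an ET-system with accuracy `k` on `[a, b]`: the functions are smooth on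
`[a, b]` and the maximal number of zeros is exactly `n + k`. -/
structure IsETSystemWithAccuracy {n : ℕ} (a b : ℝ) (u : Fin (n + 1) → ℝ → ℝ) (k : ℕ) : Prop where
  smooth : ∀ i, ContDiffOn ℝ ∞ (u i) (Set.Icc a b)
  maxZeros_eq : maxZeros a b u = ((n + k : ℕ) : ℕ∞)

/-- On `(0, ∞)`, the Wronskians `W_0, …, W_{n-1}` have no zero, and `W_n` has exactly one zero,
namely `ξ`, which is simple. -/
structure OnlyLastWronskianVanishes {n : ℕ} (u : Fin (n + 1) → ℝ → ℝ) (ξ : ℝ) : Prop where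
  pos : 0 < ξ
  ne_zero : ∀ i, i < Fin.last n → ∀ x, 0 < x → leadingWronskian u i x ≠ 0
  eq_zero_iff : ∀ x, 0 < x → (leadingWronskian u (Fin.last n) x = 0 ↔ x = ξ)
  simple : deriv (leadingWronskian u (Fin.last n)) ξ ≠ 0

/- The functions below are considered on `(0, ∞)`; for `k ≥ 1` no exponent is truncated. -/

def u1 (_k : ℕ) (_x : ℝ) : ℝ := 1

def u2 (_k : ℕ) (x : ℝ) : ℝ := x

def u3 (k : ℕ) (x : ℝ) : ℝ := x ^ (2 * k - 2)

def u4 (k : ℕ) (x : ℝ) : ℝ := x ^ (2 * k)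

def u5 (k : ℕ) (x : ℝ) : ℝ := x ^ (2 * k + 1)

def u6 (k : ℕ) (x : ℝ) : ℝ := x ^ (4 * k - 2)

def u9 (k : ℕ) (x : ℝ) : ℝ := x ^ (6 * k - 2)

def u12 (k : ℕ) (x : ℝ) : ℝ := x * (1 + x ^ (4 * k))

def u13 (k : ℕ) (x : ℝ) : ℝ := x ^ (4 * k) + x ^ 2

def u15 (k : ℕ) (x : ℝ) : ℝ := (x ^ (4 * k) + x ^ 2) * Real.arctan (x ^ (2 * k - 1))

def u16 (k : ℕ) (x : ℝ) : ℝ := (x ^ (4 * k - 2) + 1) * (2 * (k : ℝ) * x ^ (4 * k - 1) + x)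

def u17 (k : ℕ) (x : ℝ) : ℝ :=
  (x ^ (4 * k - 2) + 1) * (2 * (k : ℝ) * x ^ (4 * k - 1) + x) * Real.arctan (x ^ (2 * k - 1))

def familyF1 (k : ℕ) : Fin 3 → ℝ → ℝ := ![u1 k, u12 k, u4 k]

def familyF2 (k : ℕ) : Fin 4 → ℝ → ℝ := ![u13 k, u15 k, u5 k, u2 k]

def familyF4 (k : ℕ) : Fin 6 → ℝ → ℝ := ![u4 k, u9 k, u6 k, u3 k, u16 k, u17 k]

def familyF6 (k : ℕ) : Fin 7 → ℝ → ℝ := ![u1 k, u4 k, u9 k, u6 k, u3 k, u16 k, u17 k]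

/-- All Wronskians of `u` on `(0, ∞)` are nonvanishing except the last, which has exactly one zero
`ξ`, and that zero is simple; and `u` is an ET-system with accuracy `1` on each `[a, b] ⊂ (0, ∞)`
that contains `ξ`, with accuracy `0` on each `[a, b] ⊂ (0, ∞)` that does not. -/
def IsAccuracyOneFamily {n : ℕ} (u : Fin (n + 1) → ℝ → ℝ) : Prop :=
  ∃ ξ : ℝ, OnlyLastWronskianVanishes u ξ ∧
    ∀ a b : ℝ, 0 < a → a < b →
      (ξ ∈ Set.Icc a b → IsETSystemWithAccuracy a b u 1) ∧
      (ξ ∉ Set.Icc a b → IsETSystemWithAccuracy a b u 0)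

end

/-!
A linear combination of `v₀, …, vₙ` is divided by `v₀` and differentiated. By Rolle's theorem,
with multiplicities, this loses at most one zero, and it leaves a combination of the `n`
functions `(v₁ / v₀)', …, (vₙ / v₀)'`, whose leading Wronskians are those of `v₀, …, vₙ`, shifted
by one, up to powers of `v₀` (`leadingWronskian_cons`). After `n` steps only the last Wronskian
is left, so a nontrivial combination has at most `n` zeros more than `Wₙ`
(`zeroCount_linearCombination_le`), that is `n + 1` if the simple zero `ξ` of `Wₙ` lies in
`[a, b]`, and `n` otherwise. Both bounds are attained at a single point: at `ξ` the Wronskian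
matrix is singular, so some combination vanishes to order `n + 1` there, and at `a` a combination
vanishing to order `n` always exists. So only the zeros of the Wronskians matter
(`OnlyLastWronskianVanishes.isAccuracyOneFamily`).

For the concrete families the same reduction computes the Wronskians up to nonvanishing factors
(`OnlyLastWronskianVanishes.cons`). When the first function is a power `x ^ p`, it applies the
Euler operator `x d/dx - p` to the others (`OnlyLastWronskianVanishes.monomial_cons`). With
`t = x ^ (2 k - 1)` the functions `u₁₆` and `u₁₇` are `x q(t)` and `x q(t) arctan t` for an even
quartic `q`, a shape that Euler operators keep up to a rational summand. Once all powers are used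
up, the last Wronskian is a polynomial `M` in `t ^ 2`, up to such factors. Exactly one zero of `M`
is positive, and it is simple, because `s M'(s) - e M(s)` is negative for some `e` and all
`s > 0` and `M` takes both signs (`exists_unique_simple_zero`).
-/

open Set Filter Topology

/-! ### Wronskians and division by the first function -/

theorem wronskian_congr {m : ℕ} {v w : Fin m → ℝ → ℝ} {x : ℝ} (h : ∀ i, v i =ᶠ[𝓝 x] w i) :
    wronskian v x = wronskian w x := by
  unfold wronskian
  congr 1
  ext r c
  exact (h c).iteratedDeriv_eq r

/-- By the Leibniz rule the Wronskian matrix of `w v₁, …, w vₘ` is the one of `v₁, …, vₘ`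
multiplied on the left by a lower triangular matrix with diagonal entries `w x`. -/
theorem wronskian_mul {m : ℕ} {w : ℝ → ℝ} {v : Fin m → ℝ → ℝ} {x : ℝ}
    (hw : ContDiffAt ℝ ∞ w x) (hv : ∀ i, ContDiffAt ℝ ∞ (v i) x) :
    wronskian (fun i y => w y * v i y) x = w x ^ m * wronskian v x := by
  set A : Matrix (Fin m) (Fin m) ℝ := Matrix.of fun r j =>
    ((r : ℕ).choose j : ℝ) * iteratedDeriv ((r : ℕ) - j) w x with hA
  have hdet : A.det = w x ^ m := by
    rw [Matrix.det_of_isLowerTriangular]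
    · simp [hA]
    · intro i j hij
      have : (i : ℕ) < j := hij
      simp [hA, Nat.choose_eq_zero_of_lt this]
  rw [← hdet]
  unfold wronskian
  rw [← Matrix.det_mul]
  congr 1
  ext r c
  simp only [Matrix.of_apply, Matrix.mul_apply, hA]
  have hr : iteratedDeriv (r : ℕ) (fun y => w y * v c y) x
      = iteratedDeriv (r : ℕ) (fun y => v c y * w y) x := by
    simp only [mul_comm]
  rw [hr, iteratedDeriv_fun_mul ((hv c).of_le (by exact_mod_cast le_top))
    (hw.of_le (by exact_mod_cast le_top)),
    Fin.sum_univ_eq_sum_range (fun j => ((r : ℕ).choose j : ℝ) * iteratedDeriv ((r : ℕ) - j) w x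
      * iteratedDeriv j (v c) x) m]
  have hsub : Finset.range ((r : ℕ) + 1) ⊆ Finset.range m := by
    intro i hi
    simp only [Finset.mem_range] at hi ⊢
    omega
  rw [← Finset.sum_subset hsub]
  · refine Finset.sum_congr rfl fun j _ => by ring
  · intro j _ hj
    simp only [Finset.mem_range, not_lt] at hj
    rw [Nat.choose_eq_zero_of_lt (by omega)]
    simp

theorem wronskian_cons_one {m : ℕ} (v : Fin m → ℝ → ℝ) (x : ℝ) :
    wronskian (Fin.cons (fun _ => 1) v : Fin (m + 1) → ℝ → ℝ) x
      = wronskian (fun i => deriv (v i)) x := by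
  unfold wronskian
  rw [Matrix.det_succ_column_zero, Fin.sum_univ_succ]
  have h0 : ∀ i : Fin m, iteratedDeriv ((i : ℕ) + 1) (fun _ : ℝ => (1 : ℝ)) x = 0 := by
    intro i
    rw [iteratedDeriv_const]
    simp
  simp only [Matrix.of_apply, Fin.cons_zero, Fin.val_zero, iteratedDeriv_zero, pow_zero, one_mul,
    Fin.val_succ, h0, mul_zero, zero_mul, Finset.sum_const_zero, add_zero]
  congr 1
  ext r c
  simp [iteratedDeriv_succ', Matrix.submatrix]

theorem leadingWronskian_zero {n : ℕ} (v : Fin (n + 1) → ℝ → ℝ) : leadingWronskian v 0 = v 0 := by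
  funext x
  unfold leadingWronskian wronskian
  erw [Matrix.det_fin_one]
  simp
  rfl

/-- If `(vᵢ / v₀)' = h wᵢ`, the leading Wronskians of `v₀, v₁, …` and those of `w₁, w₂, …`,
shifted by one, agree up to powers of `v₀` and `h`. -/
theorem leadingWronskian_cons {n : ℕ} {v₀ h : ℝ → ℝ} {v w : Fin (n + 1) → ℝ → ℝ}
    (hv₀ : ContDiffOn ℝ ∞ v₀ (Ioi 0)) (hv₀' : ∀ x, 0 < x → v₀ x ≠ 0)
    (hh : ContDiffOn ℝ ∞ h (Ioi 0)) (hv : ∀ i, ContDiffOn ℝ ∞ (v i) (Ioi 0))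
    (hw : ∀ i, ContDiffOn ℝ ∞ (w i) (Ioi 0))
    (hd : ∀ i x, 0 < x → HasDerivAt (fun y => v i y / v₀ y) (h x * w i x) x)
    (i : Fin (n + 1)) {x : ℝ} (hx : 0 < x) :
    leadingWronskian (Fin.cons v₀ v : Fin (n + 2) → ℝ → ℝ) i.succ x
      = v₀ x ^ ((i : ℕ) + 2) * h x ^ ((i : ℕ) + 1) * leadingWronskian w i x := by
  have hnhds : ∀ᶠ y in 𝓝 x, 0 < y := Ioi_mem_nhds hx
  have hsm : ∀ {f : ℝ → ℝ}, ContDiffOn ℝ ∞ f (Ioi 0) → ContDiffAt ℝ ∞ f x :=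
    fun hf => hf.contDiffAt (Ioi_mem_nhds hx)
  have e1 : leadingWronskian (Fin.cons v₀ v : Fin (n + 2) → ℝ → ℝ) i.succ x
      = wronskian (fun (j : Fin ((i : ℕ) + 1 + 1)) y => v₀ y *
        (Fin.cons (fun _ => 1) (fun (l : Fin ((i : ℕ) + 1)) z => v (Fin.castLE i.isLt l) z / v₀ z) :
          Fin ((i : ℕ) + 1 + 1) → ℝ → ℝ) j y) x := by
    refine wronskian_congr fun j => ?_
    filter_upwards [hnhds] with y hy
    induction j using Fin.cases with
    | zero => simp
    | succ l =>
      have : Fin.castLE i.succ.isLt l.succ = (Fin.castLE i.isLt l).succ := rfl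
      rw [this]
      simp [mul_div_cancel₀ _ (hv₀' y hy)]
  rw [e1, wronskian_mul (hsm hv₀), wronskian_cons_one]
  · have e2 : wronskian (fun l : Fin ((i : ℕ) + 1) =>
        deriv fun z => v (Fin.castLE i.isLt l) z / v₀ z) x
        = wronskian (fun (l : Fin ((i : ℕ) + 1)) y => h y * w (Fin.castLE i.isLt l) y) x := by
      refine wronskian_congr fun l => ?_
      filter_upwards [hnhds] with y hy
      exact (hd _ y hy).deriv
    rw [e2, wronskian_mul (hsm hh) (fun l => hsm (hw _))]
    unfold leadingWronskian
    ring
  · intro j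
    induction j using Fin.cases with
    | zero => exact contDiffAt_const
    | succ l => exact (hsm (hv _)).div (hsm hv₀) (hv₀' x hx)

/-- The reduction step for Wronskians: divide by the first function, differentiate, and drop a
common nonvanishing factor `h`. Neither the zeros nor their simplicity change. -/
theorem OnlyLastWronskianVanishes.cons {n : ℕ} {v₀ h : ℝ → ℝ} {v w : Fin (n + 1) → ℝ → ℝ} {ξ : ℝ}
    (H : OnlyLastWronskianVanishes w ξ)
    (hv₀ : ContDiffOn ℝ ∞ v₀ (Ioi 0)) (hv₀' : ∀ x, 0 < x → v₀ x ≠ 0)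
    (hh : ContDiffOn ℝ ∞ h (Ioi 0)) (hh' : ∀ x, 0 < x → h x ≠ 0)
    (hv : ∀ i, ContDiffOn ℝ ∞ (v i) (Ioi 0)) (hw : ∀ i, ContDiffOn ℝ ∞ (w i) (Ioi 0))
    (hd : ∀ i x, 0 < x → HasDerivAt (fun y => v i y / v₀ y) (h x * w i x) x) :
    OnlyLastWronskianVanishes (Fin.cons v₀ v : Fin (n + 2) → ℝ → ℝ) ξ := by
  have key := fun i x hx => leadingWronskian_cons hv₀ hv₀' hh hv hw hd i (x := x) hx
  have hne : ∀ (i : Fin (n + 1)) x, 0 < x → v₀ x ^ ((i : ℕ) + 2) * h x ^ ((i : ℕ) + 1) ≠ 0 :=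
    fun i x hx => mul_ne_zero (pow_ne_zero _ (hv₀' x hx)) (pow_ne_zero _ (hh' x hx))
  refine ⟨H.pos, ?_, ?_, ?_⟩
  · intro i hi x hx
    induction i using Fin.cases with
    | zero => rw [leadingWronskian_zero]; exact hv₀' x hx
    | succ l =>
      rw [key l x hx]
      exact mul_ne_zero (hne l x hx) (H.ne_zero l (by simpa [← Fin.succ_last] using hi) x hx)
  · intro x hx
    rw [← Fin.succ_last, key _ x hx, mul_eq_zero, or_iff_right (hne _ x hx), H.eq_zero_iff x hx]
  · have hev : leadingWronskian (Fin.cons v₀ v : Fin (n + 2) → ℝ → ℝ) (Fin.last (n + 1)) =ᶠ[𝓝 ξ]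
        fun x => (v₀ x ^ (n + 2) * h x ^ (n + 1)) * leadingWronskian w (Fin.last n) x := by
      filter_upwards [Ioi_mem_nhds H.pos] with x hx
      rw [← Fin.succ_last, key _ x hx]
      simp
    have hmem := Ioi_mem_nhds H.pos
    have d1 : DifferentiableAt ℝ (fun x => v₀ x ^ (n + 2) * h x ^ (n + 1)) ξ :=
      (((hv₀.contDiffAt hmem).differentiableAt (by simp)).pow _).mul
        (((hh.contDiffAt hmem).differentiableAt (by simp)).pow _)
    have d2 := differentiableAt_of_deriv_ne_zero H.simple
    rw [hev.deriv_eq, (d1.hasDerivAt.fun_mul d2.hasDerivAt).deriv, (H.eq_zero_iff ξ H.pos).2 rfl,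
      mul_zero, zero_add]
    exact mul_ne_zero (by simpa using hne (Fin.last n) ξ H.pos) H.simple

/-! ### Counting zeros with multiplicity -/

/-- For a function smooth at `x`, the one-sided derivatives in the definition of the multiplicity
are ordinary ones. -/
theorem natCast_le_zeroMultiplicity {a b x : ℝ} (hab : a < b) (hx : x ∈ Icc a b) {f : ℝ → ℝ}
    (hf : ContDiffAt ℝ ∞ f x) (m : ℕ) :
    (m : ℕ∞) ≤ zeroMultiplicity a b f x ↔ ∀ j < m, iteratedDeriv j f x = 0 := by
  have e : ∀ j : ℕ, iteratedDerivWithin j f (Icc a b) x = iteratedDeriv j f x := fun j =>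
    iteratedDerivWithin_eq_iteratedDeriv (uniqueDiffOn_Icc hab)
      (hf.of_le (by exact_mod_cast le_top)) hx
  unfold zeroMultiplicity
  simp only [le_iInf_iff, e, Nat.cast_le]
  constructor
  · intro h j hj
    by_contra hne
    exact absurd (h j hne) (by omega)
  · intro h j hj
    by_contra hlt
    exact hj (h j (by omega))

theorem zeroMultiplicity_le_mul {a b x : ℝ} (hab : a < b) (hx : x ∈ Icc a b) {f g F : ℝ → ℝ}
    (hf : ContDiffAt ℝ ∞ f x) (hg : ContDiffAt ℝ ∞ g x) (hF : F =ᶠ[𝓝 x] fun y => g y * f y) :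
    zeroMultiplicity a b f x ≤ zeroMultiplicity a b F x := by
  have hFc : ContDiffAt ℝ ∞ F x := (hg.mul hf).congr_of_eventuallyEq hF
  refine ENat.forall_natCast_le_iff_le.1 fun m hm => ?_
  rw [natCast_le_zeroMultiplicity hab hx hf] at hm
  rw [natCast_le_zeroMultiplicity hab hx hFc]
  intro j hj
  rw [hF.iteratedDeriv_eq, iteratedDeriv_fun_mul (hg.of_le (by exact_mod_cast le_top))
    (hf.of_le (by exact_mod_cast le_top))]
  refine Finset.sum_eq_zero fun i _ => ?_
  rw [hm (j - i) (by omega), mul_zero]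

theorem zeroMultiplicity_le_deriv_add_one {a b x : ℝ} (hab : a < b) (hx : x ∈ Icc a b)
    {f f' : ℝ → ℝ} (hf : ContDiffAt ℝ ∞ f x) (hf' : ContDiffAt ℝ ∞ f' x)
    (hd : deriv f =ᶠ[𝓝 x] f') :
    zeroMultiplicity a b f x ≤ zeroMultiplicity a b f' x + 1 := by
  refine ENat.forall_natCast_le_iff_le.1 fun m hm => ?_
  rcases m with _ | m
  · simp
  · rw [natCast_le_zeroMultiplicity hab hx hf] at hm
    push_cast
    gcongr
    rw [natCast_le_zeroMultiplicity hab hx hf']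
    intro j hj
    rw [← hd.iteratedDeriv_eq, ← iteratedDeriv_succ']
    exact hm (j + 1) (by omega)

theorem zeroMultiplicity_eq_zero {a b x : ℝ} {f : ℝ → ℝ} (h : f x ≠ 0) :
    zeroMultiplicity a b f x = 0 := by
  refine le_antisymm ?_ (zero_le)
  exact iInf₂_le (0 : ℕ) (by simpa using h)

theorem zeroCount_le_mul {a b : ℝ} (ha : 0 < a) (hab : a < b) {f g F : ℝ → ℝ}
    (hf : ContDiffOn ℝ ∞ f (Ioi 0)) (hg : ContDiffOn ℝ ∞ g (Ioi 0))
    (hF : ∀ y, 0 < y → F y = g y * f y) : zeroCount a b f ≤ zeroCount a b F := by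
  refine iSup₂_le fun S hS => le_trans (Finset.sum_le_sum fun x hx => ?_)
    (le_iSup₂ (f := fun (S : Finset ℝ) (_ : (S : Set ℝ) ⊆ Icc a b) =>
      ∑ x ∈ S, zeroMultiplicity a b F x) S hS)
  have hmem : Ioi (0 : ℝ) ∈ 𝓝 x := Ioi_mem_nhds (ha.trans_le (hS hx).1)
  refine zeroMultiplicity_le_mul hab (hS hx) (hf.contDiffAt hmem) (hg.contDiffAt hmem) ?_
  filter_upwards [hmem] with y hy using hF y hy

/-- Rolle's theorem with multiplicities: a zero of `f` of multiplicity `m` is a zero of `f'` of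
multiplicity at least `m - 1`, and between consecutive zeros of `f` there is a further zero of
`f'`. -/
theorem zeroCount_le_deriv_add_one {a b : ℝ} (ha : 0 < a) (hab : a < b) {f f' : ℝ → ℝ}
    (hf : ContDiffOn ℝ ∞ f (Ioi 0)) (hf' : ContDiffOn ℝ ∞ f' (Ioi 0))
    (hd : ∀ x, 0 < x → HasDerivAt f (f' x) x) :
    zeroCount a b f ≤ zeroCount a b f' + 1 := by
  refine iSup₂_le fun S hS => ?_
  have hpos : ∀ x ∈ Icc a b, 0 < x := fun x hx => ha.trans_le hx.1
  set S₀ := S.filter (fun x => f x = 0) with hS₀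
  have hS₀S : ∀ x ∈ S₀, x ∈ Icc a b := fun x hx => hS (Finset.mem_filter.1 hx).1
  have hsum : ∑ x ∈ S, zeroMultiplicity a b f x = ∑ x ∈ S₀, zeroMultiplicity a b f x := by
    refine (Finset.sum_subset (Finset.filter_subset _ _) fun x hx hx' => ?_).symm
    exact zeroMultiplicity_eq_zero fun h0 => hx' (Finset.mem_filter.2 ⟨hx, h0⟩)
  have hrolle : ∀ x y, x ∈ S₀ → y ∈ S₀ → x < y → ∃ z, z ∈ Ioo x y ∧ f' z = 0 := by
    intro x y hx hy hxy
    have hx0 := hpos x (hS₀S x hx)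
    refine exists_hasDerivAt_eq_zero hxy ?_
      (((Finset.mem_filter.1 hx).2).trans ((Finset.mem_filter.1 hy).2).symm)
      fun z hz => hd z (hx0.trans hz.1)
    exact fun z hz => (hd z (hx0.trans_le hz.1)).continuousAt.continuousWithinAt
  choose! c hc hc0 using hrolle
  -- one Rolle point for each pair of zeros; those of consecutive zeros lie outside `S₀`
  set T := ((S₀ ×ˢ S₀).filter fun p => p.1 < p.2).image fun p => c p.1 p.2 with hT
  have hTmem : ∀ z ∈ T, z ∈ Icc a b ∧ f' z = 0 := by
    intro z hz
    simp only [hT, Finset.mem_image, Finset.mem_filter, Finset.mem_product] at hz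
    obtain ⟨⟨x, y⟩, ⟨⟨hx, hy⟩, hxy⟩, rfl⟩ := hz
    have := hc x y hx hy hxy
    exact ⟨⟨(hS₀S x hx).1.trans this.1.le, this.2.le.trans (hS₀S y hy).2⟩, hc0 x y hx hy hxy⟩
  have hcard : S₀.card ≤ (T \ S₀).card + 1 := by
    refine Finset.card_le_sdiff_of_interleaved fun x hx y hy hxy _ => ?_
    refine ⟨c x y, ?_, (hc x y hx hy hxy).1, (hc x y hx hy hxy).2⟩
    simp only [hT, Finset.mem_image, Finset.mem_filter, Finset.mem_product]
    exact ⟨(x, y), ⟨⟨hx, hy⟩, hxy⟩, rfl⟩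
  have hone : ∀ z ∈ T, 1 ≤ zeroMultiplicity a b f' z := by
    intro z hz
    have := natCast_le_zeroMultiplicity hab (hTmem z hz).1
      (hf'.contDiffAt (Ioi_mem_nhds (hpos z (hTmem z hz).1))) 1
    rw [Nat.cast_one] at this
    rw [this]
    intro j hj
    obtain rfl : j = 0 := by omega
    simpa using (hTmem z hz).2
  calc ∑ x ∈ S, zeroMultiplicity a b f x = ∑ x ∈ S₀, zeroMultiplicity a b f x := hsum
    _ ≤ ∑ x ∈ S₀, (zeroMultiplicity a b f' x + 1) := by
        refine Finset.sum_le_sum fun x hx => ?_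
        have hmem : Ioi (0 : ℝ) ∈ 𝓝 x := Ioi_mem_nhds (hpos x (hS₀S x hx))
        refine zeroMultiplicity_le_deriv_add_one hab (hS₀S x hx) (hf.contDiffAt hmem)
          (hf'.contDiffAt hmem) ?_
        filter_upwards [hmem] with y hy using (hd y hy).deriv
    _ = ∑ x ∈ S₀, zeroMultiplicity a b f' x + (S₀.card : ℕ∞) := by
        rw [Finset.sum_add_distrib]; simp
    _ ≤ ∑ x ∈ S₀, zeroMultiplicity a b f' x + (((T \ S₀).card : ℕ∞) + 1) := by
        gcongr; exact_mod_cast hcard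
    _ ≤ ∑ x ∈ S₀, zeroMultiplicity a b f' x
          + (∑ x ∈ T \ S₀, zeroMultiplicity a b f' x + 1) := by
        gcongr
        calc ((T \ S₀).card : ℕ∞) = ∑ x ∈ T \ S₀, 1 := by simp
          _ ≤ _ := Finset.sum_le_sum fun x hx => hone x (Finset.mem_sdiff.1 hx).1
    _ = ∑ x ∈ S₀ ∪ T, zeroMultiplicity a b f' x + 1 := by
        rw [← add_assoc, ← Finset.sum_union Finset.disjoint_sdiff, Finset.union_sdiff_self_eq_union]
    _ ≤ zeroCount a b f' + 1 := by
        gcongr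
        refine le_iSup₂ (f := fun (S : Finset ℝ) (_ : (S : Set ℝ) ⊆ Icc a b) =>
          ∑ x ∈ S, zeroMultiplicity a b f' x) (S₀ ∪ T) ?_
        intro x hx
        rcases Finset.mem_union.1 (Finset.mem_coe.1 hx) with h | h
        exacts [hS₀S x h, (hTmem x h).1]

theorem contDiffOn_leadingWronskian {n : ℕ} {v : Fin (n + 1) → ℝ → ℝ}
    (hv : ∀ i, ContDiffOn ℝ ∞ (v i) (Ioi 0)) (i : Fin (n + 1)) :
    ContDiffOn ℝ ∞ (leadingWronskian v i) (Ioi 0) := by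
  have hit : ∀ (j : ℕ) {f : ℝ → ℝ}, ContDiffOn ℝ ∞ f (Ioi 0) →
      ContDiffOn ℝ ∞ (iteratedDeriv j f) (Ioi 0) := by
    intro j
    induction j with
    | zero => intro f hf; simpa using hf
    | succ j ih =>
      intro f hf
      rw [iteratedDeriv_succ]
      exact (ih hf).deriv_of_isOpen isOpen_Ioi (by simp)
  have : leadingWronskian v i = fun x => ∑ σ : Equiv.Perm (Fin ((i : ℕ) + 1)),
      ((Equiv.Perm.sign σ : ℤ) : ℝ) *
        ∏ j, iteratedDeriv ((σ j : Fin _) : ℕ) (v (Fin.castLE i.isLt j)) x := by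
    funext x
    unfold leadingWronskian wronskian
    rw [Matrix.det_apply']
    simp
  rw [this]
  exact ContDiffOn.sum fun σ _ => contDiffOn_const.mul (contDiffOn_prod fun j _ => hit _ (hv _))

/-! ### From Wronskians to the maximal number of zeros -/

/-- The upper bound on zeros: when all leading Wronskians but the last are nonvanishing on
`(0, ∞)`, a nontrivial combination of `n + 1` functions has at most `n` more zeros than the last
Wronskian. Induction on `n`: dividing by `v₀` and differentiating costs one zero and leaves a
combination of `n` functions. -/
theorem zeroCount_linearCombination_le {a b : ℝ} (ha : 0 < a) (hab : a < b) {K : ℕ∞} {n : ℕ}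
    {v : Fin (n + 1) → ℝ → ℝ} (hv : ∀ i, ContDiffOn ℝ ∞ (v i) (Ioi 0))
    (hne : ∀ i, i < Fin.last n → ∀ x, 0 < x → leadingWronskian v i x ≠ 0)
    (hK : zeroCount a b (leadingWronskian v (Fin.last n)) ≤ K) {c : Fin (n + 1) → ℝ} (hc : c ≠ 0) :
    zeroCount a b (fun x => ∑ i, c i * v i x) ≤ n + K := by
  induction n with
  | zero =>
    have hc0 : c 0 ≠ 0 := fun h => hc (funext fun i => by
      rw [show i = 0 from Fin.fin_one_eq_zero i, h]; rfl)
    have hK' : zeroCount a b (v 0) ≤ K := by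
      have := leadingWronskian_zero v
      rw [← this]; exact hK
    simp only [Nat.cast_zero, zero_add]
    refine le_trans (zeroCount_le_mul ha hab (g := fun _ => (c 0)⁻¹)
      (ContDiffOn.sum fun i _ => contDiffOn_const.mul (hv i)) contDiffOn_const fun y _ => ?_) hK'
    rw [Fin.sum_univ_one]
    field_simp
  | succ n ih =>
    have hv0 : ∀ x, 0 < x → v 0 x ≠ 0 := by
      have := hne 0 (by simp [Fin.lt_def])
      rwa [leadingWronskian_zero] at this
    set w : Fin (n + 1) → ℝ → ℝ := fun i => deriv fun y => v i.succ y / v 0 y with hwdef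
    have hq : ∀ i, ContDiffOn ℝ ∞ (fun y => v i y / v 0 y) (Ioi 0) := fun i =>
      (hv i).div (hv 0) hv0
    have hw : ∀ i, ContDiffOn ℝ ∞ (w i) (Ioi 0) := fun i =>
      (hq i.succ).deriv_of_isOpen isOpen_Ioi (by simp)
    have hd : ∀ i x, 0 < x → HasDerivAt (fun y => v (Fin.succ i) y / v 0 y) (w i x) x :=
      fun i x hx => (((hq i.succ).contDiffAt (Ioi_mem_nhds hx)).differentiableAt
        (by simp)).hasDerivAt
    have key : ∀ i x, 0 < x → leadingWronskian v (Fin.succ i) x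
        = v 0 x ^ ((i : ℕ) + 2) * leadingWronskian w i x := by
      intro i x hx
      have := leadingWronskian_cons (h := fun _ => 1) (v := fun i => v i.succ) (hv 0) hv0
        contDiffOn_const (fun i => hv i.succ) hw (fun i x hx => by simpa using hd i x hx) i hx
      rw [show (Fin.cons (v 0) fun i => v i.succ : Fin (n + 2) → ℝ → ℝ) = v from
        Fin.cons_self_tail v] at this
      simpa using this
    -- if only `c 0` is nonzero, the combination is a multiple of `v 0` and has no zero
    by_cases hc' : (fun i : Fin (n + 1) => c i.succ) = 0
    · have hc0 : c 0 ≠ 0 := by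
        intro h0
        refine hc (funext fun i => ?_)
        induction i using Fin.cases with
        | zero => exact h0
        | succ l => exact congrFun hc' l
      refine iSup₂_le fun S hS => ?_
      rw [Finset.sum_eq_zero]
      · exact zero_le
      · intro x hx
        refine zeroMultiplicity_eq_zero ?_
        rw [Fin.sum_univ_succ]
        have : ∀ i : Fin (n + 1), c i.succ = 0 := fun i => congrFun hc' i
        simp only [this, zero_mul, Finset.sum_const_zero, add_zero]
        exact mul_ne_zero hc0 (hv0 x (ha.trans_le (hS hx).1))
    · have hKw : zeroCount a b (leadingWronskian w (Fin.last n)) ≤ K := by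
        refine le_trans (zeroCount_le_mul ha hab (contDiffOn_leadingWronskian hw _)
          ((hv 0).pow (n + 2)) fun y hy => ?_) hK
        rw [← Fin.succ_last, key _ y hy]
        simp
      have step := ih hw (fun i hi x hx => by
        have := hne i.succ (by simpa [← Fin.succ_last] using hi) x hx
        rw [key i x hx] at this
        exact right_ne_zero_of_mul this) hKw hc'
      have hF : ContDiffOn ℝ ∞ (fun x => ∑ i, c i * v i x) (Ioi 0) :=
        ContDiffOn.sum fun i _ => contDiffOn_const.mul (hv i)
      have hQ : ContDiffOn ℝ ∞ (fun x => c 0 + ∑ i : Fin (n + 1), c i.succ * (v i.succ x / v 0 x))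
          (Ioi 0) :=
        contDiffOn_const.add (ContDiffOn.sum fun i _ => contDiffOn_const.mul (hq _))
      calc zeroCount a b (fun x => ∑ i, c i * v i x)
          ≤ zeroCount a b
              (fun x => c 0 + ∑ i : Fin (n + 1), c i.succ * (v i.succ x / v 0 x)) := by
            refine zeroCount_le_mul ha hab hF ((hv 0).inv hv0) fun y hy => ?_
            rw [Fin.sum_univ_succ (fun i => c i * v i y), mul_add, Finset.mul_sum, Pi.inv_apply]
            have := hv0 y hy
            congr 1
            · field_simp
            · refine Finset.sum_congr rfl fun i _ => by field_simp
        _ ≤ zeroCount a b (fun x => ∑ i : Fin (n + 1), c i.succ * w i x) + 1 := by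
            refine zeroCount_le_deriv_add_one ha hab hQ
              (ContDiffOn.sum fun i _ => contDiffOn_const.mul (hw i)) fun x hx => ?_
            refine HasDerivAt.const_add _ (HasDerivAt.fun_sum fun i _ => ?_)
            exact (hd i x hx).const_mul _
        _ ≤ (n + K) + 1 := by gcongr
        _ = ((n + 1 : ℕ) : ℕ∞) + K := by push_cast; ring

theorem zeroCount_eq_top_of_eq_zero {a b : ℝ} (hab : a < b) {f : ℝ → ℝ}
    (hf : ∀ x ∈ Icc a b, f x = 0) : zeroCount a b f = ⊤ := by
  refine top_le_iff.1 ?_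
  have h : zeroMultiplicity a b f a = ⊤ := by
    unfold zeroMultiplicity
    refine iInf₂_eq_top.2 fun j hj => absurd ?_ hj
    have : EqOn f (fun _ => 0) (Icc a b) := hf
    rw [iteratedDerivWithin_congr this (left_mem_Icc.2 hab.le)]
    simp
  rw [← h]
  refine le_trans ?_ (le_iSup₂ (f := fun (S : Finset ℝ) (_ : (S : Set ℝ) ⊆ Icc a b) =>
    ∑ x ∈ S, zeroMultiplicity a b f x) {a} (by simpa using hab.le))
  simp

/-- The count is `1` at most, since `ξ` is a simple zero, and `0` when `ξ` is outside `[a, b]`.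
-/
theorem OnlyLastWronskianVanishes.zeroCount_le {a b : ℝ} (ha : 0 < a) (hab : a < b) {n : ℕ}
    {v : Fin (n + 1) → ℝ → ℝ} {ξ : ℝ} (H : OnlyLastWronskianVanishes v ξ)
    (hv : ∀ i, ContDiffOn ℝ ∞ (v i) (Ioi 0)) (k : ℕ) (hk : ξ ∈ Icc a b → 1 ≤ k) :
    zeroCount a b (leadingWronskian v (Fin.last n)) ≤ k := by
  refine iSup₂_le fun S hS => ?_
  have h0 : ∀ x ∈ S, x ≠ ξ → zeroMultiplicity a b (leadingWronskian v (Fin.last n)) x = 0 :=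
    fun x hx hne => zeroMultiplicity_eq_zero fun h =>
      hne ((H.eq_zero_iff x (ha.trans_le (hS hx).1)).1 h)
  by_cases hξ : ξ ∈ S
  · rw [Finset.sum_eq_single_of_mem ξ hξ fun x hx hne => h0 x hx hne]
    refine le_trans ?_ (Nat.cast_le.2 (hk (hS hξ)))
    by_contra hlt
    have h2 : ((2 : ℕ) : ℕ∞) ≤ zeroMultiplicity a b (leadingWronskian v (Fin.last n)) ξ := by
      have := Order.add_one_le_of_lt (not_le.1 hlt)
      simpa [one_add_one_eq_two] using this
    rw [natCast_le_zeroMultiplicity hab (hS hξ)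
      ((contDiffOn_leadingWronskian hv _).contDiffAt (Ioi_mem_nhds H.pos))] at h2
    exact H.simple (by simpa using h2 1 (by omega))
  · rw [Finset.sum_eq_zero fun x hx => h0 x hx fun h => hξ (h ▸ hx)]
    exact zero_le

/-- A nontrivial combination with a zero of multiplicity `n + k` at a single point shows that the
upper bound is attained. -/
theorem maxZeros_eq_of_exists {a b : ℝ} (ha : 0 < a) (hab : a < b) {n k : ℕ}
    {v : Fin (n + 1) → ℝ → ℝ} (hv : ∀ i, ContDiffOn ℝ ∞ (v i) (Ioi 0))
    (hne : ∀ i, i < Fin.last n → ∀ x, 0 < x → leadingWronskian v i x ≠ 0)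
    (hK : zeroCount a b (leadingWronskian v (Fin.last n)) ≤ k)
    {x : ℝ} (hx : x ∈ Icc a b) {c : Fin (n + 1) → ℝ} (hc : c ≠ 0)
    (hcx : ∀ r < n + k, ∑ i, c i * iteratedDeriv r (v i) x = 0) :
    maxZeros a b v = ((n + k : ℕ) : ℕ∞) := by
  have hub := fun (c : Fin (n + 1) → ℝ) (hc : c ≠ 0) =>
    zeroCount_linearCombination_le ha hab hv hne hK hc
  refine le_antisymm ?_ ?_
  · refine iSup₂_le fun f hf => iSup_le fun hf0 => ?_
    obtain ⟨d, rfl⟩ := (Submodule.mem_span_range_iff_exists_fun ℝ).1 hf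
    have hd : d ≠ 0 := by
      rintro rfl
      simp at hf0
    have := hub d hd
    have e : (∑ i, d i • v i) = fun x => ∑ i, d i * v i x := by
      funext y; simp
    rw [e]
    exact_mod_cast this
  · set f : ℝ → ℝ := fun x => ∑ i, c i * v i x with hfdef
    have hfmem : f ∈ Submodule.span ℝ (Set.range v) :=
      (Submodule.mem_span_range_iff_exists_fun ℝ).2 ⟨c, by funext y; simp [hfdef]⟩
    -- a combination vanishing on all of `[a, b]` would have infinitely many zeros
    have hf0 : ∃ x ∈ Icc a b, f x ≠ 0 := by
      by_contra! hcon
      have := hub c hc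
      rw [zeroCount_eq_top_of_eq_zero hab hcon, top_le_iff] at this
      exact absurd this (by exact_mod_cast ENat.natCast_ne_top (n + k))
    have hmem : Ioi (0 : ℝ) ∈ 𝓝 x := Ioi_mem_nhds (ha.trans_le hx.1)
    have hmul : ((n + k : ℕ) : ℕ∞) ≤ zeroMultiplicity a b f x := by
      rw [natCast_le_zeroMultiplicity hab hx
        (ContDiffAt.sum fun i _ => contDiffAt_const.mul ((hv i).contDiffAt hmem))]
      intro j hj
      rw [iteratedDeriv_fun_sum fun i _ =>
        (contDiffAt_const.mul ((hv i).contDiffAt hmem)).of_le (by exact_mod_cast le_top)]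
      simp only [iteratedDeriv_const_mul_field]
      exact hcx j hj
    calc ((n + k : ℕ) : ℕ∞) ≤ zeroMultiplicity a b f x := hmul
      _ = ∑ y ∈ {x}, zeroMultiplicity a b f y := by simp
      _ ≤ zeroCount a b f := le_iSup₂ (f := fun (S : Finset ℝ) (_ : (S : Set ℝ) ⊆ Icc a b) =>
          ∑ y ∈ S, zeroMultiplicity a b f y) {x} (by simpa using hx)
      _ ≤ maxZeros a b v := le_iSup₂_of_le f hfmem (le_iSup_of_le hf0 le_rfl)

theorem OnlyLastWronskianVanishes.isAccuracyOneFamily {n : ℕ} {v : Fin (n + 1) → ℝ → ℝ} {ξ : ℝ}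
    (H : OnlyLastWronskianVanishes v ξ) (hv : ∀ i, ContDiffOn ℝ ∞ (v i) (Ioi 0)) :
    IsAccuracyOneFamily v := by
  refine ⟨ξ, H, fun a b ha hab =>
    ⟨fun hξ => ⟨fun i => (hv i).mono fun x hx => ha.trans_le hx.1, ?_⟩,
    fun hξ => ⟨fun i => (hv i).mono fun x hx => ha.trans_le hx.1, ?_⟩⟩⟩
  -- at `ξ` the full Wronskian matrix is singular: a kernel vector gives a zero of order `n + 1`
  · have hdet := (H.eq_zero_iff ξ H.pos).2 rfl
    obtain ⟨c, hc, hMc⟩ := Matrix.exists_mulVec_eq_zero_iff.2 hdet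
    refine maxZeros_eq_of_exists ha hab hv H.ne_zero
      (H.zeroCount_le ha hab hv 1 fun _ => le_rfl) hξ hc fun r hr => ?_
    have := congrFun hMc ⟨r, hr⟩
    simp only [Matrix.mulVec, dotProduct, Matrix.of_apply, Pi.zero_apply] at this
    rw [← this]
    exact Finset.sum_congr rfl fun i _ => mul_comm _ _
  -- `n` linear conditions on `n + 1` coefficients: some combination vanishes to order `n` at `a`
  · set M : Matrix (Fin n) (Fin (n + 1)) ℝ := Matrix.of fun r i => iteratedDeriv (r : ℕ) (v i) a
    have hker : M.mulVecLin.ker ≠ ⊥ := LinearMap.ker_ne_bot_of_finrank_lt (by simp)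
    obtain ⟨c, hcM, hc⟩ := Submodule.exists_mem_ne_zero_of_ne_bot hker
    refine maxZeros_eq_of_exists ha hab hv H.ne_zero
      (H.zeroCount_le ha hab hv 0 fun h => absurd h hξ) (left_mem_Icc.2 hab.le) hc fun r hr => ?_
    have := congrFun (LinearMap.mem_ker.1 hcM) ⟨r, hr⟩
    simp only [Matrix.mulVecLin_apply, Matrix.mulVec, dotProduct, M, Matrix.of_apply,
      Pi.zero_apply] at this
    rw [← this]
    exact Finset.sum_congr rfl fun i _ => mul_comm _ _

/-! ### Simple zeros of one function -/

/-- If `s M'(s) < e M(s)` for all `s > 0`, then `M(s) s⁻ᵉ` is strictly decreasing, so `M` has at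
most one positive zero, and `M' < 0` there. For a polynomial whose coefficients change sign once
from `+` to `-`, any `e` between the two exponents at the sign change will do. -/
theorem exists_unique_simple_zero {M M' : ℝ → ℝ} (hM : ∀ s, 0 < s → HasDerivAt M (M' s) s) (e : ℝ)
    (he : ∀ s, 0 < s → s * M' s < e * M s) {s₀ s₁ : ℝ} (h₀ : 0 < s₀) (h₁ : 0 < s₁)
    (hM₀ : 0 < M s₀) (hM₁ : M s₁ < 0) :
    ∃ η, 0 < η ∧ (∀ s, 0 < s → (M s = 0 ↔ s = η)) ∧ M' η ≠ 0 := by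
  have hφ : ∀ s, 0 < s → HasDerivAt (fun s => M s * s ^ (-e))
      (M' s * s ^ (-e) + M s * (-e * s ^ (-e - 1))) s := fun s hs =>
    (hM s hs).mul (Real.hasDerivAt_rpow_const (Or.inl hs.ne'))
  have hanti : StrictAntiOn (fun s => M s * s ^ (-e)) (Ioi 0) := by
    refine strictAntiOn_of_deriv_neg (convex_Ioi 0)
      (fun s hs => (hφ s hs).continuousAt.continuousWithinAt) fun s hs => ?_
    rw [interior_Ioi] at hs
    have hs' : (0 : ℝ) < s := hs
    rw [(hφ s hs').deriv, Real.rpow_sub_one hs'.ne']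
    have hp := Real.rpow_pos_of_pos hs' (-e)
    have : M' s * s ^ (-e) + M s * (-e * (s ^ (-e) / s))
        = (s * M' s - e * M s) * (s ^ (-e) / s) := by
      field_simp
      ring
    rw [this]
    exact mul_neg_of_neg_of_pos (by linarith [he s hs']) (by positivity)
  have hsub : uIcc s₀ s₁ ⊆ Ioi 0 := fun s hs => (lt_min h₀ h₁).trans_le hs.1
  obtain ⟨η, hη, hη0⟩ : (0 : ℝ) ∈ M '' uIcc s₀ s₁ :=
    intermediate_value_uIcc (fun s hs => (hM s (hsub hs)).continuousAt.continuousWithinAt)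
      (by rw [uIcc_of_ge (hM₁.trans hM₀).le]; exact ⟨hM₁.le, hM₀.le⟩)
  have hηpos : 0 < η := hsub hη
  refine ⟨η, hηpos, fun s hs => ⟨fun h => ?_, fun h => h ▸ hη0⟩, fun h => ?_⟩
  · exact hanti.injOn hs hηpos (by simp [h, hη0])
  · have := he η hηpos
    rw [h, hη0] at this
    simp at this

theorem exists_onlyLastWronskianVanishes_comp_pow {M M' : ℝ → ℝ}
    (hM : ∀ s, 0 < s → HasDerivAt M (M' s) s) (e : ℝ)
    (he : ∀ s, 0 < s → s * M' s < e * M s) {s₀ s₁ : ℝ} (h₀ : 0 < s₀) (h₁ : 0 < s₁)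
    (hM₀ : 0 < M s₀) (hM₁ : M s₁ < 0) {n : ℕ} (hn : n ≠ 0) :
    ∃ ξ, OnlyLastWronskianVanishes (n := 0) ![fun x => M (x ^ n)] ξ := by
  obtain ⟨η, hη, hiff, hsimple⟩ := exists_unique_simple_zero hM e he h₀ h₁ hM₀ hM₁
  have hroot : (η ^ ((n : ℝ)⁻¹)) ^ n = η := Real.rpow_inv_natCast_pow hη.le hn
  have hpos : 0 < η ^ ((n : ℝ)⁻¹) := Real.rpow_pos_of_pos hη _
  have hW : leadingWronskian (n := 0) ![fun x => M (x ^ n)] (Fin.last 0) = fun x => M (x ^ n) :=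
    leadingWronskian_zero (n := 0) _
  refine ⟨η ^ ((n : ℝ)⁻¹), hpos, fun i hi => absurd hi (by omega), fun x hx => ?_, ?_⟩
  · rw [hW, hiff _ (pow_pos hx n)]
    constructor
    · intro h
      rw [← h, Real.pow_rpow_inv_natCast hx.le hn]
    · rintro rfl
      exact hroot
  · have hd : HasDerivAt (fun x => M (x ^ n)) (M' η * (n * (η ^ ((n : ℝ)⁻¹)) ^ (n - 1)))
        (η ^ ((n : ℝ)⁻¹)) :=
      HasDerivAt.comp (h := fun x : ℝ => x ^ n) _ (by rw [hroot]; exact hM η hη)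
        (hasDerivAt_pow n _)
    rw [hW]
    refine hd.deriv ▸ mul_ne_zero hsimple (mul_ne_zero (by exact_mod_cast hn) (pow_pos hpos _).ne')

/-! ### Euler operators and functions with an arctangent -/

/-- `w = (x d/dx - p) v` on `(0, ∞)`, both functions being smooth there. -/
structure EulerStep (p : ℝ) (v w : ℝ → ℝ) : Prop where
  smooth_left : ContDiffOn ℝ ∞ v (Ioi 0)
  smooth_right : ContDiffOn ℝ ∞ w (Ioi 0)
  hasDerivAt : ∀ x, 0 < x → HasDerivAt v ((w x + p * v x) / x) x

theorem EulerStep.monomial (p : ℝ) {c d : ℝ} {q : ℕ} (h : d = (q - p) * c) :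
    EulerStep p (fun x => c * x ^ q) (fun x => d * x ^ q) := by
  refine ⟨by fun_prop, by fun_prop, fun x hx => ?_⟩
  refine ((hasDerivAt_pow q x).const_mul c).congr_deriv ?_
  rcases q with _ | q
  · simp [h]
  · rw [h]
    push_cast
    rw [pow_succ]
    field_simp
    ring

/-- The reduction step for a first function `c x ^ q`: since
`(v / x ^ q)' = x ^ (-q - 1) (x d/dx - q) v`, it applies the Euler operator `x d/dx - q` to the
other functions. -/
theorem OnlyLastWronskianVanishes.monomial_cons {n : ℕ} {v w : Fin (n + 1) → ℝ → ℝ} {ξ : ℝ}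
    (H : OnlyLastWronskianVanishes w ξ) {c : ℝ} {q : ℕ} (hc : c ≠ 0)
    (hvw : ∀ i, EulerStep q (v i) (w i)) :
    OnlyLastWronskianVanishes (Matrix.vecCons (fun x => c * x ^ q) v) ξ := by
  have hne : ∀ x : ℝ, 0 < x → c * x ^ q ≠ 0 := fun x hx => mul_ne_zero hc (pow_pos hx q).ne'
  refine H.cons (h := fun x => (x * (c * x ^ q))⁻¹) (by fun_prop) hne
    (ContDiffOn.inv (by fun_prop) fun x hx => mul_ne_zero (ne_of_gt hx) (hne x hx))
    (fun x hx => inv_ne_zero (mul_ne_zero hx.ne' (hne x hx)))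
    (fun i => (hvw i).smooth_left) (fun i => (hvw i).smooth_right) fun i x hx => ?_
  have h0 := (EulerStep.monomial (q : ℝ) (c := c) (d := 0) (q := q) (by simp)).hasDerivAt x hx
  have hx' := hx.ne'
  refine (((hvw i).hasDerivAt x hx).div h0 (hne x hx)).congr_deriv ?_
  field_simp
  ring

/-- The function `x (F(t) arctan t + G(t))` of `x`, where `t = x ^ (2 m + 1)`. -/
noncomputable def arctanForm (m : ℕ) (F G : ℝ → ℝ) (x : ℝ) : ℝ :=
  x * (F (x ^ (2 * m + 1)) * Real.arctan (x ^ (2 * m + 1)) + G (x ^ (2 * m + 1)))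

theorem contDiff_arctanForm {m : ℕ} {F G : ℝ → ℝ} (hF : ContDiff ℝ ∞ F) (hG : ContDiff ℝ ∞ G) :
    ContDiff ℝ ∞ (arctanForm m F G) := by
  have hp : ContDiff ℝ ∞ (fun x : ℝ => x ^ (2 * m + 1)) := contDiff_id.pow _
  exact contDiff_id.mul (((hF.comp hp).mul (Real.contDiff_arctan.comp hp)).add (hG.comp hp))

theorem hasDerivAt_arctanForm {m : ℕ} {F F' G G' : ℝ → ℝ} (hF : ∀ t, HasDerivAt F (F' t) t)
    (hG : ∀ t, HasDerivAt G (G' t) t) {x t : ℝ} (hx : x ≠ 0) (ht : t = x ^ (2 * m + 1)) :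
    HasDerivAt (arctanForm m F G)
      ((F t + (2 * m + 1) * t * F' t) * Real.arctan t
        + (G t + (2 * m + 1) * t * (G' t + F t / (1 + t ^ 2)))) x := by
  subst ht
  have hp : HasDerivAt (fun x : ℝ => x ^ (2 * m + 1)) ((2 * m + 1) * x ^ (2 * m)) x := by
    simpa using hasDerivAt_pow (2 * m + 1) x
  have := (hasDerivAt_id x).mul (((hF _).comp x hp).mul ((Real.hasDerivAt_arctan _).comp x hp)
    |>.add ((hG _).comp x hp))
  refine this.congr_deriv ?_
  simp only [Function.comp_apply, id, Pi.add_apply, Pi.mul_apply]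
  have : (1 + (x ^ (2 * m + 1)) ^ 2) ≠ 0 := by positivity
  field_simp
  ring

/-- For `t = x ^ (2 m + 1)` the operator `x d/dx - p` maps `x Φ(t)` to
`x ((1 - p) Φ(t) + (2 m + 1) t Φ'(t))`. -/
theorem EulerStep.arctanForm {m : ℕ} {F F' G G' F₂ G₂ : ℝ → ℝ} {p : ℝ}
    (hFs : ContDiff ℝ ∞ F) (hGs : ContDiff ℝ ∞ G) (hF₂s : ContDiff ℝ ∞ F₂) (hG₂s : ContDiff ℝ ∞ G₂)
    (hF : ∀ t, HasDerivAt F (F' t) t) (hG : ∀ t, HasDerivAt G (G' t) t)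
    (hF₂ : ∀ t, F₂ t = (1 - p) * F t + (2 * m + 1) * t * F' t)
    (hG₂ : ∀ t, G₂ t = (1 - p) * G t + (2 * m + 1) * t * (G' t + F t / (1 + t ^ 2))) :
    EulerStep p (arctanForm m F G) (arctanForm m F₂ G₂) := by
  refine ⟨(contDiff_arctanForm hFs hGs).contDiffOn, (contDiff_arctanForm hF₂s hG₂s).contDiffOn,
    fun x hx => ?_⟩
  refine (hasDerivAt_arctanForm hF hG hx.ne' rfl).congr_deriv ?_
  unfold _root_.arctanForm
  rw [hF₂, hG₂]
  field_simp
  ring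

/-- The even quartic with coefficients `a`, `b`, `c`. -/
def evenQuartic (a b c t : ℝ) : ℝ := a + b * t ^ 2 + c * t ^ 4

/-- The odd polynomial of degree at most `11` with the given coefficients. -/
def oddPoly (c₀ c₁ c₂ c₃ c₄ c₅ t : ℝ) : ℝ :=
  c₀ * t + c₁ * t ^ 3 + c₂ * t ^ 5 + c₃ * t ^ 7 + c₄ * t ^ 9 + c₅ * t ^ 11

theorem contDiff_evenQuartic (a b c : ℝ) : ContDiff ℝ ∞ (evenQuartic a b c) := by
  unfold evenQuartic; fun_prop

theorem hasDerivAt_evenQuartic (a b c t : ℝ) :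
    HasDerivAt (evenQuartic a b c) (2 * b * t + 4 * c * t ^ 3) t := by
  have := (((hasDerivAt_pow 2 t).const_mul b).const_add a).add ((hasDerivAt_pow 4 t).const_mul c)
  refine this.congr_deriv ?_
  norm_num
  ring

theorem contDiff_oddPoly_div (c₀ c₁ c₂ c₃ c₄ c₅ : ℝ) (e : ℕ) :
    ContDiff ℝ ∞ (fun t => oddPoly c₀ c₁ c₂ c₃ c₄ c₅ t / (1 + t ^ 2) ^ e) := by
  unfold oddPoly
  exact ContDiff.div (by fun_prop) (by fun_prop) fun t => by positivity

theorem hasDerivAt_oddPoly_div (c₀ c₁ c₂ c₃ c₄ c₅ : ℝ) (e : ℕ) (t : ℝ) :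
    HasDerivAt (fun t => oddPoly c₀ c₁ c₂ c₃ c₄ c₅ t / (1 + t ^ 2) ^ e)
      (((c₀ + 3 * c₁ * t ^ 2 + 5 * c₂ * t ^ 4 + 7 * c₃ * t ^ 6 + 9 * c₄ * t ^ 8
        + 11 * c₅ * t ^ 10) * (1 + t ^ 2) - 2 * e * t * oddPoly c₀ c₁ c₂ c₃ c₄ c₅ t)
        / (1 + t ^ 2) ^ (e + 1)) t := by
  have h1 : HasDerivAt (oddPoly c₀ c₁ c₂ c₃ c₄ c₅)
      (c₀ + 3 * c₁ * t ^ 2 + 5 * c₂ * t ^ 4 + 7 * c₃ * t ^ 6 + 9 * c₄ * t ^ 8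
        + 11 * c₅ * t ^ 10) t := by
    have := (((((hasDerivAt_id t).const_mul c₀).add ((hasDerivAt_pow 3 t).const_mul c₁)).add
      ((hasDerivAt_pow 5 t).const_mul c₂)).add ((hasDerivAt_pow 7 t).const_mul c₃)).add
      ((hasDerivAt_pow 9 t).const_mul c₄) |>.add ((hasDerivAt_pow 11 t).const_mul c₅)
    refine this.congr_deriv ?_
    norm_num
    ring
  have h2 : HasDerivAt (fun t : ℝ => (1 + t ^ 2) ^ e)
      (e * (1 + t ^ 2) ^ e * (2 * t) / (1 + t ^ 2)) t := by
    refine (((hasDerivAt_pow 2 t).const_add 1).pow e).congr_deriv ?_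
    rcases e with _ | e
    · simp
    · have : (1 + t ^ 2) ≠ 0 := by positivity
      rw [Nat.add_sub_cancel, pow_succ]
      field_simp
      simp
      ring
  have hne : (1 + t ^ 2) ≠ 0 := by positivity
  refine (h1.div h2 (by positivity)).congr_deriv ?_
  field_simp
  ring

theorem evenQuartic_ne_zero {a b c : ℝ} (ha : 0 < a) (hdisc : 0 < 4 * a * c - b ^ 2) (t : ℝ) :
    evenQuartic a b c t ≠ 0 := by
  have h : 4 * a * evenQuartic a b c t
      = (2 * a + b * t ^ 2) ^ 2 + (4 * a * c - b ^ 2) * (t ^ 2) ^ 2 := by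
    unfold evenQuartic; ring
  intro h0
  rw [h0, mul_zero] at h
  have h1 : (4 * a * c - b ^ 2) * (t ^ 2) ^ 2 = 0 := by
    nlinarith [sq_nonneg (2 * a + b * t ^ 2), mul_nonneg hdisc.le (sq_nonneg (t ^ 2))]
  have h2 : t ^ 2 = 0 := by simpa [hdisc.ne'] using h1
  rw [h2, mul_zero, add_zero, zero_pow two_ne_zero, mul_zero, add_zero] at h
  have : 0 < (2 * a) ^ 2 := by positivity
  exact this.ne h

theorem EulerStep.evenQuartic {m : ℕ} {p a b c a' b' c' : ℝ} (ha : a' = (1 - p) * a)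
    (hb : b' = (1 - p + 2 * (2 * m + 1)) * b) (hc : c' = (1 - p + 4 * (2 * m + 1)) * c) :
    EulerStep p (_root_.arctanForm m 0 (_root_.evenQuartic a b c))
      (_root_.arctanForm m 0 (_root_.evenQuartic a' b' c')) := by
  refine EulerStep.arctanForm contDiff_const (contDiff_evenQuartic _ _ _) contDiff_const
    (contDiff_evenQuartic _ _ _) (fun t => hasDerivAt_const t 0)
    (hasDerivAt_evenQuartic _ _ _) (by simp) fun t => ?_
  simp only [_root_.evenQuartic, ha, hb, hc, Pi.zero_apply]
  ring

/-- The first Euler step on `x q(t) arctan t`, where `1 + t ^ 2` divides the quartic `q`. The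
rational part is then a polynomial, written with the denominator `(1 + t ^ 2) ^ 0`. -/
theorem EulerStep.evenQuartic_arctan_first {m : ℕ} {p a b c a' b' c' c₀' c₁' : ℝ}
    (ha : a' = (1 - p) * a)
    (hb : b' = (1 - p + 2 * (2 * m + 1)) * b) (hc : c' = (1 - p + 4 * (2 * m + 1)) * c)
    (hg : ∀ t : ℝ, (1 + t ^ 2) * (c₀' * t + c₁' * t ^ 3)
      = (2 * m + 1) * t * _root_.evenQuartic a b c t) :
    EulerStep p (_root_.arctanForm m (_root_.evenQuartic a b c) 0)
      (_root_.arctanForm m (_root_.evenQuartic a' b' c')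
        (fun t => oddPoly c₀' c₁' 0 0 0 0 t / (1 + t ^ 2) ^ 0)) := by
  refine EulerStep.arctanForm (contDiff_evenQuartic _ _ _) contDiff_const
    (contDiff_evenQuartic _ _ _) (contDiff_oddPoly_div _ _ _ _ _ _ _)
    (hasDerivAt_evenQuartic _ _ _) (fun t => hasDerivAt_const t 0) (fun t => ?_) fun t => ?_
  · simp only [_root_.evenQuartic, ha, hb, hc]
    ring
  · have : (1 + t ^ 2) ≠ 0 := by positivity
    simp only [Pi.zero_apply, mul_zero, zero_add, pow_zero, div_one]
    rw [← mul_div_assoc, ← hg, oddPoly]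
    field_simp
    ring

/-- An Euler step raises the exponent of the denominator `(1 + t ^ 2) ^ e` by one. -/
theorem EulerStep.evenQuartic_arctan {m : ℕ}
    {p a b c a' b' c' c₀ c₁ c₂ c₃ c₄ c₅ c₀' c₁' c₂' c₃' c₄' c₅' : ℝ} {e : ℕ}
    (ha : a' = (1 - p) * a)
    (hb : b' = (1 - p + 2 * (2 * m + 1)) * b) (hc : c' = (1 - p + 4 * (2 * m + 1)) * c)
    (hg : ∀ t : ℝ, oddPoly c₀' c₁' c₂' c₃' c₄' c₅' t
      = (1 - p) * (1 + t ^ 2) * oddPoly c₀ c₁ c₂ c₃ c₄ c₅ t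
        + (2 * m + 1) * t * ((c₀ + 3 * c₁ * t ^ 2 + 5 * c₂ * t ^ 4 + 7 * c₃ * t ^ 6 + 9 * c₄ * t ^ 8
        + 11 * c₅ * t ^ 10) * (1 + t ^ 2) - 2 * e * t * oddPoly c₀ c₁ c₂ c₃ c₄ c₅ t
          + (1 + t ^ 2) ^ e * _root_.evenQuartic a b c t)) :
    EulerStep p (_root_.arctanForm m (_root_.evenQuartic a b c)
        (fun t => oddPoly c₀ c₁ c₂ c₃ c₄ c₅ t / (1 + t ^ 2) ^ e))
      (_root_.arctanForm m (_root_.evenQuartic a' b' c')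
        (fun t => oddPoly c₀' c₁' c₂' c₃' c₄' c₅' t / (1 + t ^ 2) ^ (e + 1))) := by
  refine EulerStep.arctanForm (contDiff_evenQuartic _ _ _) (contDiff_oddPoly_div _ _ _ _ _ _ _)
    (contDiff_evenQuartic _ _ _) (contDiff_oddPoly_div _ _ _ _ _ _ _)
    (hasDerivAt_evenQuartic _ _ _) (hasDerivAt_oddPoly_div _ _ _ _ _ _ _) (fun t => ?_) fun t => ?_
  · simp only [_root_.evenQuartic, ha, hb, hc]
    ring
  · have : (1 + t ^ 2) ≠ 0 := by positivity
    rw [hg]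
    field_simp
    ring

/-- The last reduction step, for `x q(t)` and `x (q(t) arctan t + g(t) / (1 + t ^ 2) ^ e)`: the
quotient is `arctan t + g(t) / ((1 + t ^ 2) ^ e q(t))`, and the numerator of its derivative is
`C t ^ 4 M(t ^ 2)`. -/
theorem OnlyLastWronskianVanishes.arctanForm_pair {m : ℕ} {M : ℝ → ℝ} {ξ : ℝ}
    (H : OnlyLastWronskianVanishes (n := 0) ![fun x => M (x ^ (4 * m + 2))] ξ)
    (hM : ContDiff ℝ ∞ M)
    {a b c c₀ c₁ c₂ c₃ c₄ c₅ C : ℝ} {e : ℕ} (hQ : ∀ t, evenQuartic a b c t ≠ 0) (hC : C ≠ 0)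
    (hN : ∀ t : ℝ, evenQuartic a b c t ^ 2 * (1 + t ^ 2) ^ e
      + ((c₀ + 3 * c₁ * t ^ 2 + 5 * c₂ * t ^ 4 + 7 * c₃ * t ^ 6 + 9 * c₄ * t ^ 8
        + 11 * c₅ * t ^ 10) * (1 + t ^ 2) - 2 * e * t * oddPoly c₀ c₁ c₂ c₃ c₄ c₅ t)
          * evenQuartic a b c t
      - oddPoly c₀ c₁ c₂ c₃ c₄ c₅ t * (1 + t ^ 2) * (2 * b * t + 4 * c * t ^ 3)
      = C * t ^ 4 * M (t ^ 2)) :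
    OnlyLastWronskianVanishes (n := 1) ![arctanForm m 0 (evenQuartic a b c),
      arctanForm m (evenQuartic a b c)
        (fun t => oddPoly c₀ c₁ c₂ c₃ c₄ c₅ t / (1 + t ^ 2) ^ e)] ξ := by
  have hne : ∀ x, 0 < x → arctanForm m 0 (evenQuartic a b c) x ≠ 0 := by
    intro x hx
    simp only [arctanForm, Pi.zero_apply, zero_mul, zero_add]
    exact mul_ne_zero hx.ne' (hQ _)
  have hden : ∀ x, 0 < x → x * evenQuartic a b c (x ^ (2 * m + 1)) ^ 2
      * (1 + (x ^ (2 * m + 1)) ^ 2) ^ (e + 1) ≠ 0 := fun x hx =>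
    mul_ne_zero (mul_ne_zero hx.ne' (pow_ne_zero _ (hQ _))) (by positivity)
  have hQs : ContDiff ℝ ∞ fun x : ℝ => evenQuartic a b c (x ^ (2 * m + 1)) :=
    (contDiff_evenQuartic a b c).comp (contDiff_id.pow _)
  refine H.cons (v := ![_]) (h := fun x => (2 * m + 1) * C * (x ^ (2 * m + 1)) ^ 5 /
      (x * evenQuartic a b c (x ^ (2 * m + 1)) ^ 2 * (1 + (x ^ (2 * m + 1)) ^ 2) ^ (e + 1)))
    (contDiff_arctanForm contDiff_const (contDiff_evenQuartic _ _ _)).contDiffOn hne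
    (ContDiffOn.div (by fun_prop) (ContDiff.contDiffOn (by fun_prop)) hden)
    (fun x hx => div_ne_zero (by positivity) (hden x hx)) ?_ ?_ ?_
  · intro i
    fin_cases i
    exact (contDiff_arctanForm (contDiff_evenQuartic _ _ _)
      (contDiff_oddPoly_div _ _ _ _ _ _ _)).contDiffOn
  · intro i
    fin_cases i
    exact (hM.comp (contDiff_id.pow _)).contDiffOn
  · intro i x hx
    obtain rfl : i = 0 := Fin.fin_one_eq_zero i
    simp only [Matrix.cons_val_zero]
    have d0 := hasDerivAt_arctanForm (m := m) (fun t => hasDerivAt_const t (0 : ℝ))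
      (hasDerivAt_evenQuartic a b c) hx.ne' rfl
    have d1 := hasDerivAt_arctanForm (m := m) (hasDerivAt_evenQuartic a b c)
      (hasDerivAt_oddPoly_div c₀ c₁ c₂ c₃ c₄ c₅ e) hx.ne' rfl
    refine (d1.div d0 (hne x hx)).congr_deriv ?_
    have hpow : x ^ (4 * m + 2) = (x ^ (2 * m + 1)) ^ 2 := by rw [← pow_mul]; ring_nf
    rw [hpow]
    have hN' := hN (x ^ (2 * m + 1))
    have hQ' := hQ (x ^ (2 * m + 1))
    simp only [arctanForm, zero_mul, zero_add, mul_zero, zero_div, add_zero]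
    generalize x ^ (2 * m + 1) = t at *
    have ht : (1 + t ^ 2) ≠ 0 := by positivity
    rw [show (2 * (m : ℝ) + 1) * C * t ^ 5 / (x * evenQuartic a b c t ^ 2 * (1 + t ^ 2) ^ (e + 1))
      * M (t ^ 2) = (2 * (m : ℝ) + 1) * t * (C * t ^ 4 * M (t ^ 2))
        / (x * evenQuartic a b c t ^ 2 * (1 + t ^ 2) ^ (e + 1)) by ring, ← hN']
    field_simp
    ring

/-! ### The families with power functions or one arctangent -/

theorem exists_onlyLastWronskianVanishes_linear {A B : ℝ} (hA : 0 < A) (hB : 0 < B) {n : ℕ}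
    (hn : n ≠ 0) :
    ∃ ξ, OnlyLastWronskianVanishes (n := 0) ![fun x => A - B * x ^ n] ξ := by
  refine exists_onlyLastWronskianVanishes_comp_pow (M := fun s => A - B * s) (M' := fun _ => -B)
    (fun s _ => ?_) (1 / 2) (fun s hs => ?_) (s₀ := A / (2 * B)) (s₁ := 2 * A / B) (by positivity)
    (by positivity) ?_ ?_ hn
  · exact (((hasDerivAt_id' s).const_mul B).const_sub A).congr_deriv (by simp)
  · have := mul_pos hB hs
    nlinarith
  · have : B * (A / (2 * B)) = A / 2 := by field_simp
    simp only [this]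
    linarith
  · have : B * (2 * A / B) = 2 * A := by field_simp
    simp only [this]
    linarith

theorem isAccuracyOneFamily_familyF1 (m : ℕ) : IsAccuracyOneFamily (familyF1 (m + 1)) := by
  obtain ⟨ξ, H⟩ := exists_onlyLastWronskianVanishes_linear (A := 2 * m + 1)
    (B := (4 * m + 5) * (2 * m + 3)) (by positivity) (by positivity) (n := 4 * m + 4) (by omega)
  have hd : ∀ x : ℝ, HasDerivAt (fun x : ℝ => x ^ (2 * m + 2))
      ((2 * m + 2) * x ^ (2 * m + 1)) x := fun x => by
    simpa using hasDerivAt_pow (2 * m + 2) x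
  have hpos : ∀ x : ℝ, 0 < 1 + (4 * m + 5) * (x ^ (2 * m + 2)) ^ 2 := fun x => by positivity
  have H1 : OnlyLastWronskianVanishes (n := 1)
      ![fun x => 1 + (4 * m + 5) * (x ^ (2 * m + 2)) ^ 2,
        fun x => (2 * m + 2) * x ^ (2 * m + 1)] ξ := by
    refine H.cons (v := ![_]) (h := fun x => (2 * m + 2) * x ^ (2 * m)
      / (1 + (4 * m + 5) * (x ^ (2 * m + 2)) ^ 2) ^ 2) (by fun_prop) (fun x _ => (hpos x).ne')
      (ContDiffOn.div (by fun_prop) (by fun_prop) fun x _ => pow_ne_zero _ (hpos x).ne')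
      (fun x hx => ?_) ?_ ?_ ?_
    · have := hpos x
      positivity
    · intro i; fin_cases i; dsimp; fun_prop
    · intro i; fin_cases i; dsimp; fun_prop
    · intro i x hx
      obtain rfl : i = 0 := Fin.fin_one_eq_zero i
      simp only [Matrix.cons_val_zero]
      have d1 : HasDerivAt (fun x : ℝ => (2 * m + 2) * x ^ (2 * m + 1))
          ((2 * m + 2) * ((2 * m + 1) * x ^ (2 * m))) x := by
        simpa using (hasDerivAt_pow (2 * m + 1) x).const_mul (2 * (m : ℝ) + 2)
      refine (d1.div ((((hd x).fun_pow 2).const_mul _).const_add 1) (hpos x).ne').congr_deriv ?_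
      have := (hpos x).ne'
      rw [show x ^ (4 * m + 4) = (x ^ (2 * m) * x ^ 2) ^ 2 by ring]
      rw [show x ^ (2 * m + 2) = x ^ (2 * m) * x ^ 2 by ring] at this ⊢
      rw [show x ^ (2 * m + 1) = x ^ (2 * m) * x by ring]
      field_simp
      ring
  have hF : familyF1 (m + 1) = ![fun _ => 1, fun x => x * (1 + (x ^ (2 * m + 2)) ^ 2),
      fun x => x ^ (2 * m + 2)] := by
    funext i x
    fin_cases i <;> simp [familyF1, u1, u12, u4]
    · left; ring
    · ring
  have hs : ∀ i, ContDiffOn ℝ ∞ (familyF1 (m + 1) i) (Ioi 0) := by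
    rw [hF]; intro i
    fin_cases i <;> dsimp <;> fun_prop
  refine OnlyLastWronskianVanishes.isAccuracyOneFamily (ξ := ξ) ?_ hs
  rw [hF]
  refine H1.cons (v := ![_, _]) (h := fun _ => 1) (by fun_prop) (by simp) (by fun_prop)
    (by simp) ?_ ?_ ?_
  · intro i; fin_cases i <;> dsimp <;> fun_prop
  · intro i; fin_cases i <;> dsimp <;> fun_prop
  · intro i x hx
    fin_cases i
    · simp only [Fin.zero_eta, Matrix.cons_val_zero, div_one, one_mul]
      refine ((hasDerivAt_id' x).fun_mul (((hd x).fun_pow 2).const_add 1)).congr_deriv ?_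
      rw [show x ^ (2 * m + 2) = x ^ (2 * m + 1) * x by ring]
      ring
    · simpa using hd x

theorem isAccuracyOneFamily_familyF2 (m : ℕ) (hm : m ≠ 0) :
    IsAccuracyOneFamily (familyF2 (m + 1)) := by
  have hm' : 0 < (m : ℝ) := by exact_mod_cast Nat.pos_of_ne_zero hm
  obtain ⟨ξ, H⟩ := exists_onlyLastWronskianVanishes_linear (A := 6 * m + 4)
    (B := (4 * m + 3) * (2 * m)) (by positivity) (by positivity) (n := 4 * m + 2) (by omega)
  have hd : ∀ x : ℝ, x ≠ 0 → HasDerivAt (fun x : ℝ => x ^ (2 * m + 1))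
      ((2 * m + 1) * x ^ (2 * m + 1) / x) x := fun x hx => by
    refine (hasDerivAt_pow (2 * m + 1) x).congr_deriv ?_
    simp only [Nat.add_sub_cancel, pow_succ _ (2 * m)]
    push_cast
    field_simp
  have hpos : ∀ x : ℝ, 0 < 1 + (x ^ (2 * m + 1)) ^ 2 := fun x => by positivity
  -- the derivative of the quotient of the two functions has the numerator
  -- `(1 + t ^ 2) ((6 m + 4) - 2 m (4 m + 3) t ^ 2)`, with `t = x ^ (2 m + 1)`
  have H2 : OnlyLastWronskianVanishes (n := 1)
      ![fun x => -4 * (2 * m + 1) * (x * (x ^ (2 * m + 1)) ^ 3),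
        fun x => (2 * m + 2 - ((4 * m + 3) * (2 * m) - (6 * m + 4)) * (x ^ (2 * m + 1)) ^ 2
          + (2 * m + 2) * (4 * m + 3) * (x ^ (2 * m + 1)) ^ 4) / (2 * m + 1)] ξ := by
    refine H.cons (v := ![_]) (h := fun x => (2 * m + 2) * (1 + (x ^ (2 * m + 1)) ^ 2)
      / (4 * (2 * m + 1) ^ 2 * x ^ 2 * (x ^ (2 * m + 1)) ^ 3)) (by fun_prop)
      (fun x hx => ?_)
      (ContDiffOn.div (by fun_prop) (by fun_prop) fun x hx => ?_)
      (fun x hx => ?_) ?_ ?_ ?_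
    · have : 0 < 4 * (2 * (m : ℝ) + 1) * (x * (x ^ (2 * m + 1)) ^ 3) := by positivity
      simp only [neg_mul]
      exact neg_ne_zero.2 this.ne'
    · have : (0 : ℝ) < x := hx
      positivity
    · positivity
    · intro i; fin_cases i; dsimp; fun_prop
    · intro i; fin_cases i; dsimp; fun_prop
    · intro i x hx
      obtain rfl : i = 0 := Fin.fin_one_eq_zero i
      simp only [Matrix.cons_val_zero]
      have dt := hd x hx.ne'
      have hv : -4 * (2 * (m : ℝ) + 1) * (x * (x ^ (2 * m + 1)) ^ 3) ≠ 0 := by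
        have : 0 < 4 * (2 * (m : ℝ) + 1) * (x * (x ^ (2 * m + 1)) ^ 3) := by positivity
        simp only [neg_mul]
        exact neg_ne_zero.2 this.ne'
      refine ((((((dt.fun_pow 2).const_mul _).const_sub _).fun_add ((dt.fun_pow 4).const_mul
        _)).div_const _).div (((hasDerivAt_id' x).fun_mul (dt.fun_pow 3)).const_mul _)
        hv).congr_deriv ?_
      have htpos : x ^ (2 * m + 1) ≠ 0 := by positivity
      rw [show x ^ (4 * m + 2) = (x ^ (2 * m + 1)) ^ 2 by ring]
      generalize x ^ (2 * m + 1) = t at *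
      field_simp
      push_cast
      ring
  have H1 : OnlyLastWronskianVanishes (n := 2)
      ![fun x => (2 * m + 1) * (x * x ^ (2 * m + 1) * (1 + (x ^ (2 * m + 1)) ^ 2)),
        fun x => (2 * m + 1) * (x * x ^ (2 * m + 1) * (1 - (x ^ (2 * m + 1)) ^ 2)),
        fun x => -(1 + (4 * m + 3) * (x ^ (2 * m + 1)) ^ 2)] ξ := by
    refine H2.cons (v := ![_, _]) (h := fun x => 1 / (x ^ 2 * x ^ (2 * m + 1)
      * (1 + (x ^ (2 * m + 1)) ^ 2) ^ 2)) (by fun_prop) (fun x hx => by positivity)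
      (ContDiffOn.div (by fun_prop) (by fun_prop) fun x hx => ?_)
      (fun x hx => by positivity) ?_ ?_ ?_
    · have : (0 : ℝ) < x := hx
      positivity
    · intro i; fin_cases i <;> dsimp <;> fun_prop
    · intro i; fin_cases i <;> dsimp <;> fun_prop
    · intro i x hx
      have dt := hd x hx.ne'
      have hv : (2 * (m : ℝ) + 1) * (x * x ^ (2 * m + 1) * (1 + (x ^ (2 * m + 1)) ^ 2)) ≠ 0 := by
        positivity
      have d0 := ((((hasDerivAt_id' x).fun_mul dt).fun_mul ((dt.fun_pow 2).const_add 1)).const_mul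
        (2 * (m : ℝ) + 1))
      have htpos : x ^ (2 * m + 1) ≠ 0 := by positivity
      have hpos' := (hpos x).ne'
      fin_cases i
      · refine (((((hasDerivAt_id' x).fun_mul dt).fun_mul ((dt.fun_pow 2).const_sub 1)).const_mul
          (2 * (m : ℝ) + 1)).div d0 hv).congr_deriv ?_
        simp only [Fin.zero_eta,
          Matrix.cons_val_zero]
        generalize x ^ (2 * m + 1) = t at *
        field_simp
        ring
      · refine ((((dt.fun_pow 2).const_mul _).const_add 1).fun_neg.div d0 hv).congr_deriv ?_
        simp only [Fin.mk_one,
          Matrix.cons_val_one, Matrix.cons_val_fin_one]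
        generalize x ^ (2 * m + 1) = t at *
        field_simp
        ring
  have hF : familyF2 (m + 1) = ![fun x => x ^ 2 * (1 + (x ^ (2 * m + 1)) ^ 2),
      fun x => x ^ 2 * (1 + (x ^ (2 * m + 1)) ^ 2) * Real.arctan (x ^ (2 * m + 1)),
      fun x => x ^ 2 * x ^ (2 * m + 1), fun x => x] := by
    have e : 2 * (m + 1) - 1 = 2 * m + 1 := by omega
    funext i x
    fin_cases i <;> simp [familyF2, u13, u15, u5, u2, e]
    · ring
    · left; ring
    · ring
  have hs : ∀ i, ContDiffOn ℝ ∞ (familyF2 (m + 1) i) (Ioi 0) := by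
    have ha : ContDiff ℝ ∞ (fun x : ℝ => Real.arctan (x ^ (2 * m + 1))) :=
      Real.contDiff_arctan.comp (contDiff_id.pow _)
    rw [hF]; intro i
    fin_cases i <;> dsimp <;> fun_prop
  refine OnlyLastWronskianVanishes.isAccuracyOneFamily (ξ := ξ) ?_ hs
  rw [hF] at hs ⊢
  -- with `t = x ^ (2 m + 1)` the quotients by `u₁₃` are `arctan t`, `t / (1 + t ^ 2)` and
  -- `1 / (x (1 + t ^ 2))`
  refine H1.cons (v := ![_, _, _]) (h := fun x => 1 / (x ^ 2 * (1 + (x ^ (2 * m + 1)) ^ 2) ^ 2))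
    (by fun_prop) (fun x hx => by positivity)
    (ContDiffOn.div (by fun_prop) (by fun_prop) fun x hx => ?_)
    (fun x hx => by positivity) (fun i => hs i.succ) ?_ ?_
  · have : (0 : ℝ) < x := hx
    positivity
  · intro i; fin_cases i <;> dsimp <;> fun_prop
  · intro i x hx
    have dt := hd x hx.ne'
    have hv : x ^ 2 * (1 + (x ^ (2 * m + 1)) ^ 2) ≠ 0 := by positivity
    have dx2 : HasDerivAt (fun x : ℝ => x ^ 2) (2 * x) x := by simpa using hasDerivAt_pow 2 x
    have d0 := dx2.fun_mul ((dt.fun_pow 2).const_add 1)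
    have hpos' := (hpos x).ne'
    have harc := HasDerivAt.comp (h := fun x : ℝ => x ^ (2 * m + 1)) x
      (Real.hasDerivAt_arctan (x ^ (2 * m + 1))) dt
    fin_cases i
    · refine ((d0.fun_mul harc).div d0 hv).congr_deriv ?_
      simp only [Fin.zero_eta,
        Matrix.cons_val_zero, Function.comp_apply]
      generalize x ^ (2 * m + 1) = t at *
      field_simp
      ring
    · refine ((dx2.fun_mul dt).div d0 hv).congr_deriv ?_
      simp only [Fin.mk_one,
        Matrix.cons_val_one, Matrix.cons_val_zero]
      generalize x ^ (2 * m + 1) = t at *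
      field_simp
      ring
    · refine ((hasDerivAt_id' x).div d0 hv).congr_deriv ?_
      simp only [Fin.reduceFinMk,
        Matrix.cons_val]
      generalize x ^ (2 * m + 1) = t at *
      field_simp
      ring

/-! ### The families with four and five power functions -/

theorem exists_onlyLastWronskianVanishes_cubic {c₀ c₁ c₂ c₃ : ℝ} (h₀ : 0 < c₀) (h₁ : 0 ≤ c₁)
    (h₂ : 0 ≤ c₂) (h₃ : 0 < c₃) {n : ℕ} (hn : n ≠ 0) :
    ∃ ξ, OnlyLastWronskianVanishes (n := 0) ![fun x =>
      c₀ + c₁ * x ^ n + c₂ * (x ^ n) ^ 2 - c₃ * (x ^ n) ^ 3] ξ := by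
  set r : ℝ := (c₀ + c₁ + c₂) / c₃ + 1 with hr
  have hr1 : 1 ≤ r := by
    have : 0 ≤ (c₀ + c₁ + c₂) / c₃ := by positivity
    linarith
  have hrc : c₃ * r = c₀ + c₁ + c₂ + c₃ := by rw [hr]; field_simp
  set s₀ : ℝ := min 1 (c₀ / (2 * c₃)) with hs₀
  have hs₀pos : 0 < s₀ := lt_min one_pos (by positivity)
  have hs₀c : c₃ * s₀ ≤ c₀ / 2 := by
    calc c₃ * s₀ ≤ c₃ * (c₀ / (2 * c₃)) := by gcongr; exact min_le_right _ _
      _ = c₀ / 2 := by field_simp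
  refine exists_onlyLastWronskianVanishes_comp_pow
    (M := fun s => c₀ + c₁ * s + c₂ * s ^ 2 - c₃ * s ^ 3)
    -- `5 / 2` lies between the exponents `2` and `3` of the only sign change
    (M' := fun s => c₁ + 2 * c₂ * s - 3 * c₃ * s ^ 2) (fun s _ => ?_) (5 / 2) (fun s hs => ?_)
    (s₀ := s₀) (s₁ := r) hs₀pos (by linarith) ?_ ?_ hn
  · refine (((((hasDerivAt_id' s).const_mul c₁).const_add c₀).add
      ((hasDerivAt_pow 2 s).const_mul c₂)).sub ((hasDerivAt_pow 3 s).const_mul c₃)).congr_deriv ?_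
    norm_num
    ring
  · have e1 : 0 ≤ c₁ * s := by positivity
    have e2 : 0 ≤ c₂ * s ^ 2 := by positivity
    have e3 : 0 < c₃ * s ^ 3 := by positivity
    nlinarith
  · have e1 : 0 ≤ c₁ * s₀ := by positivity
    have e2 : 0 ≤ c₂ * s₀ ^ 2 := by positivity
    have e3 : c₃ * s₀ ^ 3 ≤ c₃ * s₀ := by
      have : s₀ ^ 3 ≤ s₀ := pow_le_of_le_one hs₀pos.le (min_le_left _ _) (by norm_num)
      gcongr
    linarith
  · have e0 : c₀ ≤ c₀ * r ^ 2 := le_mul_of_one_le_right h₀.le (one_le_pow₀ hr1)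
    have e1 : c₁ * r ≤ c₁ * r ^ 2 := by
      gcongr
      exact le_self_pow₀ hr1 (by norm_num)
    have e3 : c₃ * r ^ 3 = (c₀ + c₁ + c₂ + c₃) * r ^ 2 := by rw [← hrc]; ring
    have e4 : 0 < c₃ * r ^ 2 := by positivity
    rw [e3]
    linarith

/-- The images of `u₁₆` and `u₁₇` under the product of `x d/dx - p` over the exponents
`p = 2 k, 6 k - 2, 4 k - 2, 2 k - 2` of the power functions, where `K = k = m + 1 > 2`. The
coefficients `d0, …, d3` are polynomials in `K` whose expansions in powers of `K - 3` have
positive coefficients. At `K = 2` the coefficient `d3` is negative, and there is no positive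
zero. -/
theorem exists_onlyLastWronskianVanishes_arctanForm_pair {m : ℕ} (hm : 2 ≤ m) {K : ℝ}
    (hK : K = m + 1) :
    ∃ ξ, OnlyLastWronskianVanishes (n := 1)
      ![arctanForm m 0 (evenQuartic
          ((1 - 2 * K) * (3 - 6 * K) * (3 - 4 * K) * (3 - 2 * K))
          ((2 * K - 1) * (1 - 2 * K) * (1 + 2 * K) * (1 + 2 * K))
          (2 * K * (6 * K - 3) * (2 * K - 1) * (4 * K - 1) * (6 * K - 1))),
        arctanForm m (evenQuartic
          ((1 - 2 * K) * (3 - 6 * K) * (3 - 4 * K) * (3 - 2 * K))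
          ((2 * K - 1) * (1 - 2 * K) * (1 + 2 * K) * (1 + 2 * K))
          (2 * K * (6 * K - 3) * (2 * K - 1) * (4 * K - 1) * (6 * K - 1)))
          (fun t => oddPoly
            (-27 + 162 * K - 348 * K ^ 2 + 312 * K ^ 3 - 96 * K ^ 4)
            (-71 + 432 * K - 936 * K ^ 2 + 832 * K ^ 3 - 240 * K ^ 4)
            (-61 + 440 * K - 1360 * K ^ 2 + 2480 * K ^ 3 - 2800 * K ^ 4 + 1472 * K ^ 5)
            (-1 + 16 * K - 216 * K ^ 2 + 1088 * K ^ 3 - 2192 * K ^ 4 + 1536 * K ^ 5)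
            (6 * K - 84 * K ^ 2 + 408 * K ^ 3 - 816 * K ^ 4 + 576 * K ^ 5) 0 t
              / (1 + t ^ 2) ^ 3)] ξ := by
  obtain ⟨n, rfl⟩ := Nat.exists_eq_add_of_le hm
  have hKn : K = n + 3 := by rw [hK]; push_cast; ring
  have hn : (0 : ℝ) ≤ n := Nat.cast_nonneg n
  obtain ⟨d0, hd0⟩ : ∃ d : ℝ,
      d = -9 + 171 * K - 1052 * K ^ 2 + 2692 * K ^ 3 - 2816 * K ^ 4 + 960 * K ^ 5 := ⟨_, rfl⟩
  have p0 : 0 < d0 := by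
    rw [hd0, hKn]; ring_nf; positivity
  obtain ⟨d1, hd1⟩ : ∃ d : ℝ,
      d = 29 - 107 * K - 680 * K ^ 2 + 3644 * K ^ 3 - 4848 * K ^ 4 + 1728 * K ^ 5 := ⟨_, rfl⟩
  have p1 : 0 < d1 := by
    rw [hd1, hKn]; ring_nf; positivity
  obtain ⟨d2, hd2⟩ : ∃ d : ℝ,
      d = -4 + 80 * K - 996 * K ^ 2 + 3796 * K ^ 3 - 4496 * K ^ 4 + 432 * K ^ 5
      + 1152 * K ^ 6 := ⟨_, rfl⟩
  have p2 : 0 < d2 := by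
    rw [hd2, hKn]; ring_nf; positivity
  obtain ⟨d3, hd3⟩ : ∃ d : ℝ,
      d = -40 * K + 516 * K ^ 2 - 2220 * K ^ 3 + 3808 * K ^ 4 - 2640 * K ^ 5
      + 576 * K ^ 6 := ⟨_, rfl⟩
  have p3 : 0 < d3 := by
    rw [hd3, hKn]; ring_nf; positivity
  obtain ⟨ξ, H⟩ := exists_onlyLastWronskianVanishes_cubic p0 p1.le p2.le p3
    (n := 4 * (2 + n) + 2) (by omega)
  refine ⟨ξ, H.arctanForm_pair
    (M := fun s => d0 + d1 * s + d2 * s ^ 2 - d3 * s ^ 3) (by fun_prop)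
    (fun t => ?_) (C := 64 * (2 * K - 1) ^ 4) ?_ ?_⟩
  · have hA : 0 < (1 - 2 * K) * (3 - 6 * K) * (3 - 4 * K) * (3 - 2 * K) := by
      rw [hKn]; ring_nf; positivity
    have hdisc : 0 < 4 * ((1 - 2 * K) * (3 - 6 * K) * (3 - 4 * K) * (3 - 2 * K))
        * (2 * K * (6 * K - 3) * (2 * K - 1) * (4 * K - 1) * (6 * K - 1))
        - ((2 * K - 1) * (1 - 2 * K) * (1 + 2 * K) * (1 + 2 * K)) ^ 2 := by
      rw [hKn]; ring_nf; positivity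
    exact evenQuartic_ne_zero hA hdisc t
  · have : 0 < 2 * K - 1 := by rw [hKn]; linarith
    positivity
  · intro t
    simp only [evenQuartic, oddPoly, hd0, hd1, hd2, hd3]
    push_cast
    ring

/-- With `k = m + 1` the exponents `2 k - 2`, `4 k - 2`, … lose their truncated subtractions. -/
theorem u3_succ (m : ℕ) : u3 (m + 1) = fun x => 1 * x ^ (2 * m) := by
  funext x
  rw [u3, show 2 * (m + 1) - 2 = 2 * m by omega, one_mul]

theorem u4_succ (m : ℕ) : u4 (m + 1) = fun x => 1 * x ^ (2 * m + 2) := by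
  funext x
  rw [u4, show 2 * (m + 1) = 2 * m + 2 by omega, one_mul]

theorem u6_succ (m : ℕ) : u6 (m + 1) = fun x => 1 * x ^ (4 * m + 2) := by
  funext x
  rw [u6, show 4 * (m + 1) - 2 = 4 * m + 2 by omega, one_mul]

theorem u9_succ (m : ℕ) : u9 (m + 1) = fun x => 1 * x ^ (6 * m + 4) := by
  funext x
  rw [u9, show 6 * (m + 1) - 2 = 6 * m + 4 by omega, one_mul]

theorem u16_succ (m : ℕ) : u16 (m + 1)
    = arctanForm m 0 (evenQuartic 1 (1 + 2 * ((m : ℝ) + 1)) (2 * ((m : ℝ) + 1))) := by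
  funext x
  simp only [u16, arctanForm, evenQuartic, Pi.zero_apply]
  rw [show 4 * (m + 1) - 2 = 4 * m + 2 by omega, show 4 * (m + 1) - 1 = 4 * m + 3 by omega]
  push_cast
  ring

theorem u17_succ (m : ℕ) : u17 (m + 1)
    = arctanForm m (evenQuartic 1 (1 + 2 * ((m : ℝ) + 1)) (2 * ((m : ℝ) + 1))) 0 := by
  funext x
  simp only [u17, arctanForm, evenQuartic, Pi.zero_apply]
  rw [show 4 * (m + 1) - 2 = 4 * m + 2 by omega, show 4 * (m + 1) - 1 = 4 * m + 3 by omega,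
    show 2 * (m + 1) - 1 = 2 * m + 1 by omega]
  push_cast
  ring

theorem isAccuracyOneFamily_familyF4 (m : ℕ) (hm : 2 ≤ m) :
    IsAccuracyOneFamily (familyF4 (m + 1)) := by
  obtain ⟨K, hK⟩ : ∃ K : ℝ, K = m + 1 := ⟨_, rfl⟩
  obtain ⟨ξ, H⟩ := exists_onlyLastWronskianVanishes_arctanForm_pair hm hK
  have hmK : (m : ℝ) = K - 1 := by linarith
  have hm' : (m : ℝ) ≠ 0 := by have : m ≠ 0 := by omega
                               exact_mod_cast this
  have hm1 : (m : ℝ) + 1 ≠ 0 := by positivity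
  -- the power functions are restored one at a time, last to first; each list holds the images
  -- under the Euler operators of the power functions that come before
  have H3 := H.monomial_cons (c := -16 * (m + 1) ^ 2) (q := 2 * m)
    (v := ![arctanForm m 0 (evenQuartic
          ((1 - 2 * K) * (3 - 6 * K) * (3 - 4 * K))
          ((2 * K - 1) * (1 - 2 * K) * (1 + 2 * K))
          (2 * K * (6 * K - 3) * (2 * K - 1) * (4 * K - 1))),
        arctanForm m (evenQuartic
          ((1 - 2 * K) * (3 - 6 * K) * (3 - 4 * K))
          ((2 * K - 1) * (1 - 2 * K) * (1 + 2 * K))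
          (2 * K * (6 * K - 3) * (2 * K - 1) * (4 * K - 1)))
          (fun t => oddPoly (-9 + 48 * K - 84 * K ^ 2 + 48 * K ^ 3)
            (-14 + 78 * K - 144 * K ^ 2 + 88 * K ^ 3)
            (-1 - 8 * K + 84 * K ^ 2 - 208 * K ^ 3 + 160 * K ^ 4)
            (-6 * K + 48 * K ^ 2 - 120 * K ^ 3 + 96 * K ^ 4) 0 0 t / (1 + t ^ 2) ^ 2)])
    (by have : 0 < 16 * ((m : ℝ) + 1) ^ 2 := by positivity
        linarith) (by
      intro i
      fin_cases i
      · refine EulerStep.evenQuartic ?_ ?_ ?_ <;> (push_cast; rw [hmK]; ring)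
      · refine EulerStep.evenQuartic_arctan ?_ ?_ ?_ ?_
        rotate_right
        · intro t; simp only [oddPoly, evenQuartic]; push_cast; rw [hmK]; ring
        all_goals (push_cast; rw [hmK]; ring))
  have H2 := H3.monomial_cons (c := -4 * m * (m + 1)) (q := 4 * m + 2)
    (v := ![fun x => (8 * (m + 1)) * x ^ (2 * m),
        arctanForm m 0 (evenQuartic
          ((1 - 2 * K) * (3 - 6 * K))
          ((2 * K - 1) * (1 - 2 * K) * (1 + 2 * K))
          (2 * K * (6 * K - 3) * (2 * K - 1))),
        arctanForm m (evenQuartic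
          ((1 - 2 * K) * (3 - 6 * K))
          ((2 * K - 1) * (1 - 2 * K) * (1 + 2 * K))
          (2 * K * (6 * K - 3) * (2 * K - 1)))
          (fun t => oddPoly (-3 + 12 * K - 12 * K ^ 2) (-1 + 6 * K - 12 * K ^ 2 + 8 * K ^ 3)
            (6 * K - 24 * K ^ 2 + 24 * K ^ 3) 0 0 0 t / (1 + t ^ 2) ^ 1)])
    (mul_ne_zero (mul_ne_zero (by norm_num) hm') hm1) (by
      intro i
      fin_cases i
      · exact EulerStep.monomial _ (by push_cast; ring)
      · refine EulerStep.evenQuartic ?_ ?_ ?_ <;> (push_cast; rw [hmK]; ring)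
      · refine EulerStep.evenQuartic_arctan ?_ ?_ ?_ ?_
        rotate_right
        · intro t; simp only [oddPoly, evenQuartic]; push_cast; rw [hmK]; ring
        all_goals (push_cast; rw [hmK]; ring))
  have H1 := H2.monomial_cons (c := 4 * m + 2) (q := 6 * m + 4)
    (v := ![fun x => (2 * m) * x ^ (4 * m + 2), fun x => -2 * x ^ (2 * m),
        arctanForm m 0 (evenQuartic
          (1 - 2 * K) ((1 + 2 * K) * (2 * K - 1)) (2 * K * (6 * K - 3))),
        arctanForm m (evenQuartic
          (1 - 2 * K) ((1 + 2 * K) * (2 * K - 1)) (2 * K * (6 * K - 3)))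
          (fun t => oddPoly (-1 + 2 * K) (-2 * K + 4 * K ^ 2) 0 0 0 0 t / (1 + t ^ 2) ^ 0)])
    (by positivity) (by
      intro i
      fin_cases i
      · exact EulerStep.monomial _ (by push_cast; ring)
      · exact EulerStep.monomial _ (by push_cast; ring)
      · refine EulerStep.evenQuartic ?_ ?_ ?_ <;> (push_cast; rw [hmK]; ring)
      · refine EulerStep.evenQuartic_arctan ?_ ?_ ?_ ?_
        rotate_right
        · intro t; simp only [oddPoly, evenQuartic]; push_cast; rw [hmK]; ring
        all_goals (push_cast; rw [hmK]; ring))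
  have H0 := H1.monomial_cons (c := 1) (q := 2 * m + 2)
    (v := ![fun x => 1 * x ^ (6 * m + 4), fun x => 1 * x ^ (4 * m + 2), fun x => 1 * x ^ (2 * m),
        arctanForm m 0 (evenQuartic 1 (1 + 2 * K) (2 * K)),
        arctanForm m (evenQuartic 1 (1 + 2 * K) (2 * K)) 0])
    one_ne_zero (by
      intro i
      fin_cases i
      · exact EulerStep.monomial _ (by push_cast; ring)
      · exact EulerStep.monomial _ (by push_cast; ring)
      · exact EulerStep.monomial _ (by push_cast; ring)
      · refine EulerStep.evenQuartic ?_ ?_ ?_ <;> (push_cast; rw [hmK]; ring)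
      · refine EulerStep.evenQuartic_arctan_first ?_ ?_ ?_ ?_
        rotate_right
        · intro t; simp only [evenQuartic]; rw [hmK]; ring
        all_goals (push_cast; rw [hmK]; ring))
  have hF : familyF4 (m + 1) = ![fun x => 1 * x ^ (2 * m + 2), fun x => 1 * x ^ (6 * m + 4),
      fun x => 1 * x ^ (4 * m + 2), fun x => 1 * x ^ (2 * m),
      arctanForm m 0 (evenQuartic 1 (1 + 2 * K) (2 * K)),
      arctanForm m (evenQuartic 1 (1 + 2 * K) (2 * K)) 0] := by
    rw [familyF4, u4_succ, u9_succ, u6_succ, u3_succ, u16_succ, u17_succ, hK]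
  refine OnlyLastWronskianVanishes.isAccuracyOneFamily (ξ := ξ) (hF ▸ H0) ?_
  rw [hF]
  intro i
  fin_cases i
  · dsimp; fun_prop
  · dsimp; fun_prop
  · dsimp; fun_prop
  · dsimp; fun_prop
  · exact (contDiff_arctanForm contDiff_const (contDiff_evenQuartic _ _ _)).contDiffOn
  · exact (contDiff_arctanForm (contDiff_evenQuartic _ _ _) contDiff_const).contDiffOn

/-- The quartic that the last Wronskian of `familyF6 2` leads to. -/
theorem exists_onlyLastWronskianVanishes_quartic {n : ℕ} (hn : n ≠ 0) :
    ∃ ξ, OnlyLastWronskianVanishes (n := 0) ![fun x => (275788800 : ℝ) - 1235865600 * x ^ n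
      + 41211182592 * (x ^ n) ^ 2 - 19093294080 * (x ^ n) ^ 3 - 332107776 * (x ^ n) ^ 4] ξ := by
  refine exists_onlyLastWronskianVanishes_comp_pow
    (M := fun s => 275788800 - 1235865600 * s + 41211182592 * s ^ 2 - 19093294080 * s ^ 3
      - 332107776 * s ^ 4)
    -- `M` changes sign more than once, but the terms of degree `0`, `1` and `2` of
    -- `s M' - (5 / 2) M` form a negative definite quadratic
    (M' := fun s => -1235865600 + 82422365184 * s - 57279882240 * s ^ 2 - 1328431104 * s ^ 3)
    (fun s _ => ?_) (5 / 2) (fun s hs => ?_) (s₀ := 1) (s₁ := 3) (by norm_num) (by norm_num)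
    (by norm_num) (by norm_num) hn
  · refine ((((((hasDerivAt_id' s).const_mul (1235865600 : ℝ)).const_sub 275788800).add
      ((hasDerivAt_pow 2 s).const_mul 41211182592)).sub
      ((hasDerivAt_pow 3 s).const_mul 19093294080)).sub
      ((hasDerivAt_pow 4 s).const_mul 332107776)).congr_deriv ?_
    norm_num
    ring
  · have e3 : 0 < s ^ 3 := by positivity
    have e4 : 0 < s ^ 4 := by positivity
    nlinarith [sq_nonneg (s - 1 / 20)]

theorem isAccuracyOneFamily_familyF6_two : IsAccuracyOneFamily (familyF6 (1 + 1)) := by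
  obtain ⟨ξ, H⟩ := exists_onlyLastWronskianVanishes_quartic (n := 4 * 1 + 2) (by norm_num)
  have H5 := H.arctanForm_pair
    (M := fun s => 275788800 - 1235865600 * s + 41211182592 * s ^ 2 - 19093294080 * s ^ 3
      - 332107776 * s ^ 4) (by fun_prop) (a := 135) (b := -1575) (c := 108108)
    (c₀ := -135) (c₁ := 1080) (c₂ := 305586) (c₃ := 521100) (c₄ := 394821) (c₅ := 108108)
    (C := 1) (e := 4)
    (evenQuartic_ne_zero (by norm_num) (by norm_num)) one_ne_zero (by
      intro t; simp only [evenQuartic, oddPoly]; push_cast; ring)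
  have H4 := H5.monomial_cons (c := 2 * -2 * -8 * -4) (q := 2)
    (v := ![arctanForm 1 0 (evenQuartic (-135) (-315) 9828),
        arctanForm 1 (evenQuartic (-135) (-315) 9828)
          (fun t => oddPoly 135 675 20493 25893 9828 0 t / (1 + t ^ 2) ^ 3)])
    (by norm_num) (by
      intro i
      fin_cases i
      · refine EulerStep.evenQuartic ?_ ?_ ?_ <;> norm_num
      · refine EulerStep.evenQuartic_arctan (by norm_num) (by norm_num) (by norm_num) fun t => ?_
        simp only [oddPoly, evenQuartic]; push_cast; ring)
  have H3 := H4.monomial_cons (c := 6 * 2 * -4) (q := 6)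
    (v := ![fun x => (2 * -2 * -8) * x ^ 2, arctanForm 1 0 (evenQuartic 27 (-315) 1404),
        arctanForm 1 (evenQuartic 27 (-315) 1404)
          (fun t => oddPoly (-27) 270 2025 1404 0 0 t / (1 + t ^ 2) ^ 2)])
    (by norm_num) (by
      intro i
      fin_cases i
      · exact EulerStep.monomial _ (by norm_num)
      · refine EulerStep.evenQuartic ?_ ?_ ?_ <;> norm_num
      · refine EulerStep.evenQuartic_arctan (by norm_num) (by norm_num) (by norm_num) fun t => ?_
        simp only [oddPoly, evenQuartic]; push_cast; ring)
  have H2 := H3.monomial_cons (c := 10 * 6) (q := 10)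
    (v := ![fun x => (6 * 2) * x ^ 6, fun x => (2 * -2) * x ^ 2,
        arctanForm 1 0 (evenQuartic (-3) 105 468),
        arctanForm 1 (evenQuartic (-3) 105 468)
          (fun t => oddPoly 3 177 228 0 0 0 t / (1 + t ^ 2) ^ 1)])
    (by norm_num) (by
      intro i
      fin_cases i
      · exact EulerStep.monomial _ (by norm_num)
      · exact EulerStep.monomial _ (by norm_num)
      · refine EulerStep.evenQuartic ?_ ?_ ?_ <;> norm_num
      · refine EulerStep.evenQuartic_arctan (by norm_num) (by norm_num) (by norm_num) fun t => ?_
        simp only [oddPoly, evenQuartic]; push_cast; ring)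
  have H1 := H2.monomial_cons (c := 4) (q := 4)
    (v := ![fun x => 10 * x ^ 10, fun x => 6 * x ^ 6, fun x => 2 * x ^ 2,
        arctanForm 1 0 (evenQuartic 1 35 52),
        arctanForm 1 (evenQuartic 1 35 52)
          (fun t => oddPoly 3 12 0 0 0 0 t / (1 + t ^ 2) ^ 0)])
    (by norm_num) (by
      intro i
      fin_cases i
      · exact EulerStep.monomial _ (by norm_num)
      · exact EulerStep.monomial _ (by norm_num)
      · exact EulerStep.monomial _ (by norm_num)
      · refine EulerStep.evenQuartic ?_ ?_ ?_ <;> norm_num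
      · refine EulerStep.evenQuartic_arctan (by norm_num) (by norm_num) (by norm_num) fun t => ?_
        simp only [oddPoly, evenQuartic]; push_cast; ring)
  have H0 := H1.monomial_cons (c := 1) (q := 0)
    (v := ![fun x => 1 * x ^ 4, fun x => 1 * x ^ 10, fun x => 1 * x ^ 6, fun x => 1 * x ^ 2,
        arctanForm 1 0 (evenQuartic 1 5 4), arctanForm 1 (evenQuartic 1 5 4) 0])
    (by norm_num) (by
      intro i
      fin_cases i
      · exact EulerStep.monomial _ (by norm_num)
      · exact EulerStep.monomial _ (by norm_num)
      · exact EulerStep.monomial _ (by norm_num)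
      · exact EulerStep.monomial _ (by norm_num)
      · refine EulerStep.evenQuartic ?_ ?_ ?_ <;> norm_num
      · refine EulerStep.evenQuartic_arctan_first (by norm_num) (by norm_num) (by norm_num)
          fun t => ?_
        simp only [evenQuartic]; push_cast; ring)
  have hF : familyF6 (1 + 1) = ![fun x => 1 * x ^ 0, fun x => 1 * x ^ 4, fun x => 1 * x ^ 10,
      fun x => 1 * x ^ 6, fun x => 1 * x ^ 2,
      arctanForm 1 0 (evenQuartic 1 5 4), arctanForm 1 (evenQuartic 1 5 4) 0] := by
    have h1 : u1 (1 + 1) = fun x => 1 * x ^ 0 := by funext x; simp [u1]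
    have e1 : 1 + 2 * (((1 : ℕ) : ℝ) + 1) = 5 := by norm_num
    have e2 : 2 * (((1 : ℕ) : ℝ) + 1) = 4 := by norm_num
    rw [familyF6, h1, u4_succ, u9_succ, u6_succ, u3_succ, u16_succ, u17_succ, e1, e2]
  refine OnlyLastWronskianVanishes.isAccuracyOneFamily (ξ := ξ) (hF ▸ H0) ?_
  rw [hF]
  intro i
  fin_cases i
  · dsimp; fun_prop
  · dsimp; fun_prop
  · dsimp; fun_prop
  · dsimp; fun_prop
  · dsimp; fun_prop
  · exact (contDiff_arctanForm contDiff_const (contDiff_evenQuartic _ _ _)).contDiffOn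
  · exact (contDiff_arctanForm (contDiff_evenQuartic _ _ _) contDiff_const).contDiffOn

theorem proposition2 :
    (∀ k : ℕ, 1 ≤ k → IsAccuracyOneFamily (familyF1 k)) ∧
    (∀ k : ℕ, 2 ≤ k → IsAccuracyOneFamily (familyF2 k)) ∧
    (∀ k : ℕ, 2 < k → IsAccuracyOneFamily (familyF4 k)) ∧
    IsAccuracyOneFamily (familyF6 2) := by
  refine ⟨fun k hk => ?_, fun k hk => ?_, fun k hk => ?_, isAccuracyOneFamily_familyF6_two⟩
  · obtain ⟨m, rfl⟩ := Nat.exists_eq_add_of_le' hk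
    exact isAccuracyOneFamily_familyF1 m
  · obtain ⟨m, rfl⟩ : ∃ m, k = m + 1 := ⟨k - 1, by omega⟩
    exact isAccuracyOneFamily_familyF2 m (by omega)
  · obtain ⟨m, rfl⟩ : ∃ m, k = m + 1 := ⟨k - 1, by omega⟩
    exact isAccuracyOneFamily_familyF4 m (by omega)
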